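/- A Cantor set is a nonempty, compact, perfect, nowhere dense subset of $\mathbb{R}$. A gap of a Cantor set $K$ is a connected component $U$ of $\mathbb{R}\setminus K$ (two gaps are unbounded); its left and right endpoints are $U^L, U^R$ and its length is $|U| \in (0,\infty]$; $U_1 < U_2$ means $U_1^R < U_2^L$. The thickness of $K$ is $$\tau(K) = \inf_{U_1<U_2} \max\left\{\frac{U_2^L-U_1^R}{|U_1|}, \frac{U_2^L-U_1^R}{|U_2|}\right\},$$ where the infimum is over all pairs of gaps $U_1 < U_2$ of $K$ at least one of which is bounded (and $x/\infty = 0$). Put $K_+ = K\cap(0,\infty)$ and $K_- = -(K\cap(-\infty,0))$. A Cantor set $K$ is a $0^+$-Cantor set if $\min K = 0$; a $0^+_-$-Cantor set if $K_+,K_-\neq\emptyset$, $\inf K_+ = 0$ and $\inf K_- > 0$; and a $0^\times$-Cantor set if $K_+,K_-\neq\emptyset$ and $0\notin K$. Write $K\cdot L = \{xy : x\in K,\ y\in L\}$. (a) Let $K$ be a $0^+$-Cantor set, and let $L$ be a $0^+_-$-Cantor set or a $0^\times$-Cantor set. If $$\tau(L) \ge \frac{2\tau(K)+1}{\tau(K)^2}$$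 (where the right-hand side is $\infty$, so that the condition fails, when $\tau(K)=0$), then $K\cdot L$ is a nondegenerate bounded closed interval. (b) Let $M,N>0$ be real numbers with $N < \frac{2M+1}{M^2}$, and let $k\ge 2$ be an integer. Then there exist a $0^+$-Cantor set $K$ and a $0^+_-$-Cantor set $L$ with $\tau(K)=M$ and $\tau(L)=N$ such that $K\cdot L$ is a disjoint union of exactly $k$ nondegenerate bounded closed intervals; and there also exist a $0^+$-Cantor set $K$ and a $0^\times$-Cantor set $L$ with the same properties. -/

import Mathlib

open scoped Pointwise ENNReal

/-- A Cantor set on the real line: a nonempty, compact, perfect, nowhere dense subset of `ℝ`. -/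
structure IsCantorSet (K : Set ℝ) : Prop where
  nonempty : K.Nonempty
  isCompact : IsCompact K
  preperfect : Preperfect K
  isNowhereDense : IsNowhereDense K

/-- `K₊ = K ∩ (0, ∞)`. -/
def posPart' (K : Set ℝ) : Set ℝ := K ∩ Set.Ioi 0

/-- `K₋ = -(K ∩ (-∞, 0))`, a set of positive numbers. -/
def negPart' (K : Set ℝ) : Set ℝ := -(K ∩ Set.Iio 0)

/-- `0⁺`-Cantor set: a Cantor set with minimum `0`. -/
structure IsZeroPlusCantorSet (K : Set ℝ) : Prop where
  isCantorSet : IsCantorSet K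
  isLeast : IsLeast K 0

/-- `0⁺₋`-Cantor set: `K₊` and `K₋` are nonempty, `inf K₊ = 0` and `inf K₋ > 0`. -/
structure IsZeroPlusMinusCantorSet (K : Set ℝ) : Prop where
  isCantorSet : IsCantorSet K
  pos_nonempty : (posPart' K).Nonempty
  neg_nonempty : (negPart' K).Nonempty
  sInf_pos : sInf (posPart' K) = 0
  sInf_neg : 0 < sInf (negPart' K)

/-- `0ˣ`-Cantor set: `K₊` and `K₋` are nonempty and `0 ∉ K`. -/
structure IsZeroTimesCantorSet (K : Set ℝ) : Prop where
  isCantorSet : IsCantorSet K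
  pos_nonempty : (posPart' K).Nonempty
  neg_nonempty : (negPart' K).Nonempty
  zero_notMem : (0 : ℝ) ∉ K

/-- The open interval `(a, b)`, with `-∞ ≤ a < b ≤ ∞`, is a gap of the nonempty closed set `K`,
i.e. a connected component of the complement of `K`. The gaps of a nonempty compact set are
`(-∞, min K)`, `(max K, ∞)` and the bounded ones, which have both endpoints in `K`. -/
def IsGap (K : Set ℝ) (a b : EReal) : Prop :=
  a < b ∧ (a = ⊥ ∨ ∃ x ∈ K, a = (x : EReal)) ∧ (b = ⊤ ∨ ∃ x ∈ K, b = (x : EReal)) ∧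
    ∀ x ∈ K, ¬ (a < (x : EReal) ∧ (x : EReal) < b)

/-- The length `b - a` of the interval `(a, b)`; it is `∞` for an unbounded interval. -/
noncomputable def gapLength (a b : EReal) : ℝ≥0∞ := (b - a).toENNReal

/-- The thickness of `K`: the infimum, over all pairs of gaps `U₁ = (a, b)` and `U₂ = (c, d)` with
`U₁ < U₂` (that is, `b < c`), at least one of them bounded, of
`max {(c - b) / |U₁|, (c - b) / |U₂|}`, where `(c - b) / ∞ = 0`.
The endpoints `b` and `c` of such a pair are always finite. -/
noncomputable def thickness (K : Set ℝ) : ℝ≥0∞ :=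
  ⨅ (a : EReal) (b : ℝ) (c : ℝ) (d : EReal) (_ : IsGap K a b) (_ : IsGap K c d) (_ : b < c)
    (_ : a ≠ ⊥ ∨ d ≠ ⊤),
    max (ENNReal.ofReal (c - b) / gapLength a b) (ENNReal.ofReal (c - b) / gapLength c d)

/-- `S` is the disjoint union of exactly `k` nondegenerate bounded closed intervals. -/
def IsDisjointUnionOfClosedIntervals (k : ℕ) (S : Set ℝ) : Prop :=
  ∃ a b : Fin k → ℝ, (∀ i, a i < b i) ∧
    (∀ i j, i ≠ j → Disjoint (Set.Icc (a i) (b i)) (Set.Icc (a j) (b j))) ∧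
    S = ⋃ i, Set.Icc (a i) (b i)

/-! (a) This is a multiplicative gap lemma. Negative `t` reduce to positive ones by passing to `-L`,
and `0 ∈ K` settles `t = 0`. If `t > 0` in the expected range is not in `K * L`, then `K` misses
every `t / y` with `y ∈ L`. Starting from the gap of `L` around `t / max K`, one finds a gap `(u,
v)` of `K` that is linked with the inverted gap `(t / d, t / c)` of `L` (`mem_mul_of_pos`). Choose a
linked pair of least total length (`exists_minimal_linked`). Thickness and minimality keep `t` away
from the bridges next to both gaps, which gives two inequalities in `t`. Eliminating `t` contradicts
`2M + 1 ≤ N M ^ 2` (`not_linked`).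

(b) Take finite geometric towers with common ratio `μ`. The blocks of `K` have hulls `[0, κ]` and `μ
^ j * [1, κ]`; those of `L` have hulls `[-w, -δ]`, `[q, ℓ]` and `μ ^ j * [1, ℓ]`, with `1 ≤ j ≤ n =
k - 1`. The blocks are very thick, so products of blocks fill intervals (`mem_mul_of_isThick`),
while the gaps between blocks bring the thicknesses down to exactly `M` and `N`
(`exists_geometric_extension`). The strict inequality on `N` says precisely that `κ * ℓ < μ`, so the
intervals `μ ^ s * [1, κ * ℓ]` with `n < s ≤ 2n` are disjoint. All other products are absorbed by
one interval around `0`, for a total of `n + 1` (`mul_eq_iUnion_Icc`). -/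

/-- A bounded gap `(a, b)` of `K`. -/
structure IsBddGap (K : Set ℝ) (a b : ℝ) : Prop where
  left_mem : a ∈ K
  right_mem : b ∈ K
  lt : a < b
  le_or_le : ∀ x ∈ K, x ≤ a ∨ b ≤ x

/-- The gaps of `K` of length at least `ε` satisfy the inequalities defining `M ≤ τ(K)`,
where `m` and `m'` stand for the minimum and the maximum of `K`. -/
structure ThickAbove (ε M : ℝ) (K : Set ℝ) (m m' : ℝ) : Prop where
  left : ∀ a b, IsBddGap K a b → ε ≤ b - a → M * (b - a) ≤ a - m
  right : ∀ a b, IsBddGap K a b → ε ≤ b - a → M * (b - a) ≤ m' - b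
  pair : ∀ a b c d, IsBddGap K a b → IsBddGap K c d → b ≤ c → ε ≤ b - a → ε ≤ d - c →
    M * (b - a) ≤ c - b ∨ M * (d - c) ≤ c - b

/-- Real-variable form of `M ≤ τ(K)` for a compact set `K` with minimum `m`, maximum `m'`. -/
structure IsThick (M : ℝ) (K : Set ℝ) (m m' : ℝ) : Prop where
  isCompact : IsCompact K
  isLeast : IsLeast K m
  isGreatest : IsGreatest K m'
  thickAbove : ThickAbove 0 M K m m'

theorem exists_isBddGap {K : Set ℝ} (hK : IsCompact K) {x y z : ℝ} (hy : y ∈ K) (hz : z ∈ K)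
    (hyx : y ≤ x) (hxz : x ≤ z) (hx : x ∉ K) : ∃ a b, IsBddGap K a b ∧ a < x ∧ x < b := by
  obtain ⟨a, ha⟩ := (hK.inter_right (isClosed_Iic (a := x))).exists_isGreatest ⟨y, hy, hyx⟩
  obtain ⟨b, hb⟩ := (hK.inter_right (isClosed_Ici (a := x))).exists_isLeast ⟨z, hz, hxz⟩
  have hax : a < x := lt_of_le_of_ne ha.1.2 (fun h => hx (h ▸ ha.1.1))
  have hxb : x < b := lt_of_le_of_ne hb.1.2 (fun h => hx (h ▸ hb.1.1))
  refine ⟨a, b, ⟨ha.1.1, hb.1.1, hax.trans hxb, fun s hs => ?_⟩, hax, hxb⟩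
  rcases le_total s x with h | h
  · exact Or.inl (ha.2 ⟨hs, h⟩)
  · exact Or.inr (hb.2 ⟨hs, h⟩)

/-- Left endpoints of two distinct such gaps are at least `δ` apart, so `⌊a / δ⌋` determines the gap
and takes finitely many values. -/
theorem finite_isBddGap {K : Set ℝ} (hK : IsCompact K) {δ : ℝ} (hδ : 0 < δ) :
    {p : ℝ × ℝ | IsBddGap K p.1 p.2 ∧ δ ≤ p.2 - p.1}.Finite := by
  obtain ⟨A, hA⟩ := hK.bddBelow
  obtain ⟨B, hB⟩ := hK.bddAbove
  refine Set.Finite.of_injOn (f := fun p : ℝ × ℝ => ⌊p.1 / δ⌋)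
    (t := Set.Icc ⌊A / δ⌋ ⌊B / δ⌋) ?_ ?_ (Set.finite_Icc _ _)
  · rintro ⟨a, b⟩ ⟨h, -⟩
    have h1 := hA h.left_mem
    have h2 := hB h.left_mem
    constructor
    · exact Int.floor_le_floor (by gcongr)
    · exact Int.floor_le_floor (by gcongr)
  · have key : ∀ a b a' b' : ℝ, IsBddGap K a b → δ ≤ b - a → IsBddGap K a' b' →
        ⌊a / δ⌋ = ⌊a' / δ⌋ → a' ≤ a := by
      intro a b a' b' h hd h' e
      by_contra! hlt
      have h1 : b ≤ a' := (h.le_or_le a' h'.left_mem).resolve_left (not_le.2 hlt)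
      have h2 := Int.abs_sub_lt_one_of_floor_eq_floor e
      rw [abs_lt, ← sub_div, lt_div_iff₀ hδ] at h2
      linarith [h2.1]
    rintro ⟨a, b⟩ ⟨h, hd⟩ ⟨a', b'⟩ ⟨h', hd'⟩ e
    simp only at h hd h' hd' e
    have ha : a = a' := le_antisymm (key _ _ _ _ h' hd' h e.symm) (key _ _ _ _ h hd h' e)
    subst ha
    have hb1 := (h.le_or_le b' h'.right_mem).resolve_left (not_le.2 h'.lt)
    have hb2 := (h'.le_or_le b h.right_mem).resolve_left (not_le.2 h.lt)
    rw [le_antisymm hb1 hb2]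

/-! ### Linked gaps and the multiplicative gap lemma -/

/-- The gap `(u, v)` of `K` and the interval `(t / d, t / c)` are linked. -/
def Linked (t u v c d : ℝ) : Prop :=
  -- The orders `u < t/d < v < t/c` and `t/d < u < t/c < v`. Written with products, the first also
  -- makes sense for `c ≤ 0`, where `t/c` acts as `∞`.
  (u * d < t ∧ t < v * d ∧ v * c < t) ∨ (u * c < t ∧ t < u * d ∧ t < v * c)

/-- The compact set `K * L` stays at distance `ε > 0` from `t`. Linking puts `t` between products of
endpoints, which bounds both gap lengths below, so only finitely many pairs compete. -/
theorem exists_minimal_linked {K L : Set ℝ} (hK : IsCompact K) (hL : IsCompact L) {t : ℝ}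
    (hK0 : ∀ x ∈ K, 0 ≤ x) (htKL : t ∉ K * L) {u v c d : ℝ} (hU : IsBddGap K u v)
    (hV : IsBddGap L c d) (hl : Linked t u v c d) :
    ∃ u v c d, IsBddGap K u v ∧ IsBddGap L c d ∧ Linked t u v c d ∧
      ∀ u' v' c' d', IsBddGap K u' v' → IsBddGap L c' d' → Linked t u' v' c' d' →
        (v - u) + (d - c) ≤ (v' - u') + (d' - c') := by
  obtain ⟨ε, hε, hball⟩ : ∃ ε > 0, ∀ x ∈ K, ∀ y ∈ L, ε ≤ |x * y - t| := by
    have hc : IsClosed (K * L) := (hK.mul hL).isClosed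
    obtain ⟨ε, hε, h⟩ := Metric.isOpen_iff.1 hc.isOpen_compl t htKL
    refine ⟨ε, hε, fun x hx y hy => ?_⟩
    by_contra! hlt
    exact h (Metric.mem_ball.2 (by rwa [Real.dist_eq])) (Set.mul_mem_mul hx hy)
  obtain ⟨A, hA⟩ := hK.bddAbove
  obtain ⟨B, hB⟩ := hL.bddAbove
  have hsize : ∀ u v c d, IsBddGap K u v → IsBddGap L c d → Linked t u v c d →
      ε ≤ (v - u) * B ∧ ε ≤ A * (d - c) := by
    intro u v c d hU hV hl
    have hu := hK0 u hU.left_mem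
    have hvA := hA hU.right_mem
    have hdB := hB hV.right_mem
    have h1 := hU.lt
    have h2 := hV.lt
    rcases hl with ⟨h3, h4, h5⟩ | ⟨h3, h4, h5⟩
    · have e1 := hball v hU.right_mem d hV.right_mem
      rw [abs_of_pos (by linarith)] at e1
      constructor
      · nlinarith [mul_le_mul_of_nonneg_left hdB (sub_pos.2 h1).le]
      · nlinarith [mul_le_mul_of_nonneg_right hvA (sub_pos.2 h2).le]
    · have e1 := hball u hU.left_mem d hV.right_mem
      have e2 := hball v hU.right_mem c hV.left_mem
      rw [abs_of_pos (by linarith)] at e1 e2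
      constructor
      · nlinarith [mul_le_mul_of_nonneg_left (h2.le.trans hdB) (sub_pos.2 h1).le]
      · nlinarith [mul_le_mul_of_nonneg_right (h1.le.trans hvA) (sub_pos.2 h2).le]
  have hs0 := hsize u v c d hU hV hl
  have hBpos : 0 < B := by
    by_contra! h
    have := mul_nonpos_of_nonneg_of_nonpos (sub_pos.2 hU.lt).le h
    linarith [hs0.1]
  have hApos : 0 < A := by
    by_contra! h
    have := mul_nonpos_of_nonpos_of_nonneg h (sub_pos.2 hV.lt).le
    linarith [hs0.2]
  set S : Set ((ℝ × ℝ) × (ℝ × ℝ)) :=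
    {p | IsBddGap K p.1.1 p.1.2 ∧ IsBddGap L p.2.1 p.2.2 ∧ Linked t p.1.1 p.1.2 p.2.1 p.2.2}
    with hS
  have hfin : S.Finite := by
    refine ((finite_isBddGap hK (div_pos hε hBpos)).prod
      (finite_isBddGap hL (div_pos hε hApos))).subset ?_
    rintro ⟨⟨u, v⟩, ⟨c, d⟩⟩ ⟨h1, h2, h3⟩
    have := hsize _ _ _ _ h1 h2 h3
    simp only at this
    refine ⟨⟨h1, ?_⟩, ⟨h2, ?_⟩⟩
    · simp only; rw [div_le_iff₀ hBpos]; exact this.1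
    · simp only; rw [div_le_iff₀ hApos]; linarith [this.2]
  obtain ⟨⟨⟨u, v⟩, ⟨c, d⟩⟩, ⟨h1, h2, h3⟩, hmin⟩ := Set.exists_min_image S
    (fun p => (p.1.2 - p.1.1) + (p.2.2 - p.2.1)) hfin ⟨((u, v), (c, d)), hU, hV, hl⟩
  exact ⟨u, v, c, d, h1, h2, h3, fun u' v' c' d' h1 h2 h3 =>
    hmin ((u', v'), (c', d')) ⟨h1, h2, h3⟩⟩

set_option maxHeartbeats 1000000 in
theorem not_linked {K L : Set ℝ} {M N m m' n n' : ℝ} (hM : 0 < M) (hMN : 2 * M + 1 ≤ N * M ^ 2)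
    (hK : IsThick M K m m') (hL : IsThick N L n n') (hm : 0 ≤ m) {t : ℝ} (ht : 0 < t)
    (htKL : t ∉ K * L) {u v c d : ℝ} (hU : IsBddGap K u v) (hV : IsBddGap L c d) :
    ¬ Linked t u v c d := by
  intro hl
  have hK0 : ∀ x ∈ K, 0 ≤ x := fun x hx => hm.trans (hK.isLeast.2 hx)
  obtain ⟨u, v, c, d, hU, hV, hl, hmin⟩ :=
    exists_minimal_linked hK.isCompact hL.isCompact hK0 htKL hU hV hl
  have hN : 0 < N := by
    by_contra! h
    nlinarith [mul_nonneg (neg_nonneg.2 h) (sq_nonneg M)]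
  have hMN' : 2 * M + 1 ≤ (N * M) * M := by linarith
  have hMN1 : 1 < N * M := by nlinarith
  have hu0 := hK0 u hU.left_mem
  have huv := hU.lt
  have hv0 : 0 < v := hu0.trans_lt huv
  have hcd := hV.lt
  have hg : 0 < v - u := sub_pos.2 huv
  have hh : 0 < d - c := sub_pos.2 hcd
  have hUl := hK.thickAbove.left u v hU hg.le
  have hUr := hK.thickAbove.right u v hU hg.le
  have hVl := hL.thickAbove.left c d hV hh.le
  have hVr := hL.thickAbove.right c d hV hh.le
  have hu : 0 < u := by nlinarith
  have hnK : ∀ x y, x * y = t → y ∈ L → x ∉ K := fun x y e hy hx =>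
    htKL (e ▸ Set.mul_mem_mul hx hy)
  have hnL : ∀ x y, x * y = t → x ∈ K → y ∉ L := fun x y e hx hy =>
    htKL (e ▸ Set.mul_mem_mul hx hy)
  rcases hl with ⟨h3, h4, h5⟩ | ⟨h3, h4, h5⟩
  · have hd : 0 < d := by
      by_contra! h
      nlinarith
    -- Otherwise `t / u` falls in the stretch of length `N * (d - c)` to the right of `(c, d)`. The
    -- gap of `L` around it is then shorter than `(c, d)` by thickness and still linked with `(u,
    -- v)`, against minimality. The bounds `hA` and `hB` below follow the same pattern.
    have hB : u * (d + N * (d - c)) ≤ t := by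
      by_contra! hlt
      have e : u * (t / u) = t := by field_simp
      have hy1 : d < t / u := by rw [lt_div_iff₀ hu]; linarith
      have hy2 : t / u < d + N * (d - c) := by rw [div_lt_iff₀ hu]; linarith
      obtain ⟨c', d', hV', h6, h7⟩ := exists_isBddGap hL.isCompact hV.right_mem
        hL.isGreatest.1 hy1.le (by linarith) (hnL _ _ e hU.left_mem)
      have h8 : d ≤ c' := (hV'.le_or_le d hV.right_mem).resolve_right (by linarith)
      rw [lt_div_iff₀ hu] at h6
      rw [div_lt_iff₀ hu] at h7
      have h9 : d' - c' < d - c := by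
        rcases hL.thickAbove.pair _ _ _ _ hV hV' h8 hh.le (sub_pos.2 hV'.lt).le with h | h
        · nlinarith
        · have : N * (d' - c') < N * (d - c) := by nlinarith
          exact lt_of_mul_lt_mul_left this hN.le
      have := hmin u v c' d' hU hV' (Or.inr ⟨by linarith, by linarith, by nlinarith⟩)
      linarith
    have hB' : N * (d - c) * u < (v - u) * d := by nlinarith
    -- For `c ≤ 0` one has `d ≤ d - c`, hence `N * u < v - u`. With `M * (v - u) ≤ u` this
    -- contradicts `1 < N * M`.
    rcases le_or_gt c 0 with hc | hc
    · have : N * (d - c) * u < (v - u) * (d - c) := by nlinarith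
      have h6 : N * u < v - u := by
        have : (N * u) * (d - c) < (v - u) * (d - c) := by linarith
        exact lt_of_mul_lt_mul_right this hh.le
      nlinarith
    · have hA : c * (v + M * (v - u)) ≤ t := by
        by_contra! hlt
        have e : t / c * c = t := by field_simp
        have hy1 : v < t / c := by rw [lt_div_iff₀ hc]; linarith
        have hy2 : t / c < v + M * (v - u) := by rw [div_lt_iff₀ hc]; linarith
        obtain ⟨u', v', hU', h6, h7⟩ := exists_isBddGap hK.isCompact hU.right_mem
          hK.isGreatest.1 hy1.le (by linarith) (hnK _ _ e hV.left_mem)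
        have h8 : v ≤ u' := (hU'.le_or_le v hU.right_mem).resolve_right (by linarith)
        have h6' := h6
        rw [lt_div_iff₀ hc] at h6
        rw [div_lt_iff₀ hc] at h7
        have h9 : v' - u' < v - u := by
          rcases hK.thickAbove.pair _ _ _ _ hU hU' h8 hg.le (sub_pos.2 hU'.lt).le with h | h
          · linarith
          · have : M * (v' - u') < M * (v - u) := by linarith
            exact lt_of_mul_lt_mul_left this hM.le
        have := hmin u' v' c d hU' hV (Or.inr ⟨by linarith, by nlinarith, by linarith⟩)
        linarith
      -- The critical case. Put `g = v - u`, `h = d - c`. From `N h u < g d` and `M g d < h (v + M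
      -- g)` follows `N M u < v + M g`; as `M g ≤ u`, multiplying by `M` gives `N M ^ 2 < 2M + 1`.
      have h6 : M * ((v - u) * d) < (d - c) * (v + M * (v - u)) := by nlinarith
      have h7 : M * (N * (d - c) * u) < M * ((v - u) * d) := by gcongr
      have h8 : N * M * u < v + M * (v - u) := by
        have : (N * M * u) * (d - c) < (v + M * (v - u)) * (d - c) := by linarith
        exact lt_of_mul_lt_mul_right this hh.le
      have h9 : M * (N * M * u) < M * (v + M * (v - u)) := by gcongr
      nlinarith
  · have hc : 0 < c := by
      by_contra! h
      nlinarith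
    have hd : 0 < d := hc.trans hcd
    have hA : t ≤ d * (u - M * (v - u)) := by
      by_contra! hlt
      have e : t / d * d = t := by field_simp
      have hy1 : t / d < u := by rw [div_lt_iff₀ hd]; linarith
      have hy2 : u - M * (v - u) < t / d := by rw [lt_div_iff₀ hd]; linarith
      obtain ⟨u', v', hU', h6, h7⟩ := exists_isBddGap hK.isCompact hK.isLeast.1
        hU.left_mem (by linarith) hy1.le (hnK _ _ e hV.right_mem)
      have h8 : v' ≤ u := (hU'.le_or_le u hU.left_mem).resolve_left (by linarith)
      have h9 : v' - u' < v - u := by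
        rcases hK.thickAbove.pair _ _ _ _ hU' hU h8 (sub_pos.2 hU'.lt).le hg.le with h | h
        · have : M * (v' - u') < M * (v - u) := by linarith
          exact lt_of_mul_lt_mul_left this hM.le
        · linarith
      rw [lt_div_iff₀ hd] at h6
      rw [div_lt_iff₀ hd] at h7
      have := hmin u' v' c d hU' hV (Or.inl ⟨by linarith, by linarith, by nlinarith⟩)
      linarith
    have hB : t ≤ v * (c - N * (d - c)) := by
      by_contra! hlt
      have e : v * (t / v) = t := by field_simp
      have hy1 : t / v < c := by rw [div_lt_iff₀ hv0]; linarith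
      have hy2 : c - N * (d - c) < t / v := by rw [lt_div_iff₀ hv0]; linarith
      obtain ⟨c', d', hV', h6, h7⟩ := exists_isBddGap hL.isCompact hL.isLeast.1
        hV.left_mem (by linarith) hy1.le (hnL _ _ e hU.right_mem)
      have h8 : d' ≤ c := (hV'.le_or_le c hV.left_mem).resolve_left (by linarith)
      have h9 : d' - c' < d - c := by
        rcases hL.thickAbove.pair _ _ _ _ hV' hV h8 (sub_pos.2 hV'.lt).le hh.le with h | h
        · have : N * (d' - c') < N * (d - c) := by linarith
          exact lt_of_mul_lt_mul_left this hN.le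
        · linarith
      rw [lt_div_iff₀ hv0] at h6
      rw [div_lt_iff₀ hv0] at h7
      have := hmin u v c' d' hU hV' (Or.inl ⟨by nlinarith, by linarith, by linarith⟩)
      linarith
    -- In this order the two bounds yield `N * M < 1`, so only `1 < N * M` is needed.
    have h6 : M * ((v - u) * c) < (d - c) * u := by
      have := mul_pos hh (mul_pos hM hg)
      linarith
    have h7 : N * (d - c) * u < (v - u) * c := by
      have := mul_pos hg (mul_pos hN hh)
      linarith
    have h8 : M * (N * (d - c) * u) < M * ((v - u) * c) := by gcongr
    have h9 := mul_lt_mul_of_pos_right hMN1 (mul_pos hh hu)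
    linarith

/-! ### Products that fill intervals -/

theorem mem_mul_of_pos {K L : Set ℝ} {M N m' n n' : ℝ} (hM : 0 < M)
    (hMN : 2 * M + 1 ≤ N * M ^ 2) (hK : IsThick M K 0 m') (hL : IsThick N L n n')
    (hm' : 0 < m') (hn : n ≤ 0) {t : ℝ} (ht : 0 < t) (ht' : t ≤ m' * n') : t ∈ K * L := by
  by_contra htKL
  have e : m' * (t / m') = t := by field_simp
  obtain ⟨c, d, hV, h1, h2⟩ := exists_isBddGap (x := t / m') hL.isCompact hL.isLeast.1
    hL.isGreatest.1 (hn.trans (by positivity)) (by rw [div_le_iff₀ hm']; linarith)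
    (fun h => htKL (e ▸ Set.mul_mem_mul hK.isGreatest.1 h))
  have hd : 0 < d := lt_trans (by positivity) h2
  rw [lt_div_iff₀ hm'] at h1
  rw [div_lt_iff₀ hm'] at h2
  have e : t / d * d = t := by field_simp
  obtain ⟨u, v, hU, h3, h4⟩ := exists_isBddGap (x := t / d) hK.isCompact hK.isLeast.1
    hK.isGreatest.1 (by positivity) (by rw [div_le_iff₀ hd]; linarith)
    (fun h => htKL (e ▸ Set.mul_mem_mul h hV.right_mem))
  rw [lt_div_iff₀ hd] at h3
  have hv : 0 < v := lt_trans (by positivity) h4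
  rw [div_lt_iff₀ hd] at h4
  refine not_linked hM hMN hK hL le_rfl ht htKL hU hV (Or.inl ⟨h3, h4, ?_⟩)
  rcases le_or_gt c 0 with hc | hc
  · nlinarith
  · nlinarith [hK.isGreatest.2 hU.right_mem]

/-- Two sets of large thickness multiply to an interval, if their convex hulls are long compared
with their gaps. -/
theorem mem_mul_of_isThick {A B : Set ℝ} {T a b c d : ℝ} (hT : 2 ≤ T) (hA : IsThick T A a b)
    (hB : IsThick T B c d) (ha : 0 ≤ a) (hc : 0 ≤ c) (hb : 0 < b) (hab : (T + 1) * a ≤ T * b)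
    (hcd : (T + 1) * c ≤ T * d) {t : ℝ} (ht : 0 < t) (h1 : a * c ≤ t) (h2 : t ≤ b * d) :
    t ∈ A * B := by
  by_contra htAB
  have hTT : 2 * T + 1 ≤ T * T ^ 2 := by nlinarith [sq_nonneg (T - 2)]
  have hnot := @not_linked A B T T a b c d (by linarith) hTT hA hB ha t ht htAB
  have hd : 0 < d := by
    by_contra! h
    nlinarith
  rcases lt_or_ge (t / b) c with hlt | hge
  · have hc' : 0 < c := lt_trans (by positivity) hlt
    rw [div_lt_iff₀ hb] at hlt
    have e : t / c * c = t := by field_simp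
    obtain ⟨u, v, hU, h3, h4⟩ := exists_isBddGap (x := t / c) hA.isCompact hA.isLeast.1
      hA.isGreatest.1 (by rw [le_div_iff₀ hc']; linarith) (by rw [div_le_iff₀ hc']; linarith)
      (fun h => htAB (e ▸ Set.mul_mem_mul h hB.isLeast.1))
    rw [lt_div_iff₀ hc'] at h3
    rw [div_lt_iff₀ hc'] at h4
    have h5 := hA.thickAbove.left u v hU (sub_pos.2 hU.lt).le
    have hu : 0 < u := by nlinarith [hU.lt]
    have e : u * (t / u) = t := by field_simp
    obtain ⟨c', d', hV, h6, h7⟩ := exists_isBddGap (x := t / u) hB.isCompact hB.isLeast.1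
      hB.isGreatest.1 (by rw [le_div_iff₀ hu]; linarith)
      (by
        rw [div_le_iff₀ hu]
        -- A gap of `A` has endpoint ratio at most `(T + 1) / T`, which is at most the ratio of the
        -- hull of `B`. Hence `t / u` stays in that hull.
        have h8 : T * v ≤ (T + 1) * u := by linarith
        have h9 : T * t ≤ T * (d * u) := by nlinarith
        exact le_of_mul_le_mul_left h9 (by linarith))
      (fun h => htAB (e ▸ Set.mul_mem_mul hU.left_mem h))
    rw [lt_div_iff₀ hu] at h6
    rw [div_lt_iff₀ hu] at h7
    refine hnot hU hV (Or.inr ⟨by linarith, by linarith, ?_⟩)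
    nlinarith [hB.isLeast.2 hV.left_mem, hU.lt]
  · have e : b * (t / b) = t := by field_simp
    obtain ⟨c', d', hV, h3, h4⟩ := exists_isBddGap (x := t / b) hB.isCompact hB.isLeast.1
      hB.isGreatest.1 hge (by rw [div_le_iff₀ hb]; linarith)
      (fun h => htAB (e ▸ Set.mul_mem_mul hA.isGreatest.1 h))
    have hd' : 0 < d' := lt_trans (by positivity) h4
    rw [lt_div_iff₀ hb] at h3
    rw [div_lt_iff₀ hb] at h4
    have h5 := hB.thickAbove.left c' d' hV (sub_pos.2 hV.lt).le
    have e : t / d' * d' = t := by field_simp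
    obtain ⟨u, v, hU, h6, h7⟩ := exists_isBddGap (x := t / d') hA.isCompact hA.isLeast.1
      hA.isGreatest.1
      (by
        rw [le_div_iff₀ hd']
        have h8 : T * d' ≤ (T + 1) * c' := by linarith
        have h9 : T * (a * d') ≤ T * t := by
          have hc0 : 0 ≤ c' := hc.trans (hB.isLeast.2 hV.left_mem)
          have h10 := mul_le_mul_of_nonneg_left h8 ha
          have h11 := mul_le_mul_of_nonneg_right hab hc0
          have h12 := mul_le_mul_of_nonneg_left h3.le (by linarith : 0 ≤ T)
          linarith
        exact le_of_mul_le_mul_left h9 (by linarith)) (by rw [div_le_iff₀ hd']; linarith)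
      (fun h => htAB (e ▸ Set.mul_mem_mul h hV.right_mem))
    rw [lt_div_iff₀ hd'] at h6
    rw [div_lt_iff₀ hd'] at h7
    refine hnot hU hV (Or.inl ⟨h6, h7, ?_⟩)
    nlinarith [hA.isGreatest.2 hU.right_mem, hB.isLeast.2 hV.left_mem]

/-! ### Thickness as real inequalities -/

theorem IsBddGap.isGap {K : Set ℝ} {a b : ℝ} (h : IsBddGap K a b) : IsGap K a b := by
  refine ⟨by exact_mod_cast h.lt, Or.inr ⟨a, h.left_mem, rfl⟩, Or.inr ⟨b, h.right_mem, rfl⟩,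
    fun x hx hab => ?_⟩
  rw [EReal.coe_lt_coe_iff, EReal.coe_lt_coe_iff] at hab
  rcases h.le_or_le x hx with h | h <;> linarith

theorem isGap_bot {K : Set ℝ} {m : ℝ} (h : IsLeast K m) : IsGap K ⊥ m :=
  ⟨EReal.bot_lt_coe m, Or.inl rfl, Or.inr ⟨m, h.1, rfl⟩, fun x hx hab =>
    (h.2 hx).not_gt (by exact_mod_cast hab.2)⟩

theorem isGap_top {K : Set ℝ} {m : ℝ} (h : IsGreatest K m) : IsGap K m ⊤ :=
  ⟨EReal.coe_lt_top m, Or.inr ⟨m, h.1, rfl⟩, Or.inl rfl, fun x hx hab =>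
    (h.2 hx).not_gt (by exact_mod_cast hab.1)⟩

theorem IsGap.eq_or_isBddGap_right {K : Set ℝ} {b : ℝ} {a : EReal} (h : IsGap K a b) :
    (a = ⊥ ∧ IsLeast K b) ∨ ∃ x : ℝ, a = x ∧ IsBddGap K x b := by
  obtain ⟨h1, h2, h3, h4⟩ := h
  have hb : b ∈ K := by
    rcases h3 with h3 | ⟨x, hx, e⟩
    · exact absurd h3 (EReal.coe_ne_top b)
    · rwa [EReal.coe_eq_coe_iff.1 e]
  rcases h2 with rfl | ⟨x, hx, rfl⟩
  · refine Or.inl ⟨rfl, hb, fun y hy => ?_⟩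
    by_contra! hlt
    exact h4 y hy ⟨EReal.bot_lt_coe y, by exact_mod_cast hlt⟩
  · refine Or.inr ⟨x, rfl, hx, hb, by exact_mod_cast h1, fun y hy => ?_⟩
    by_contra! hlt
    exact h4 y hy ⟨by exact_mod_cast hlt.1, by exact_mod_cast hlt.2⟩

theorem IsGap.eq_or_isBddGap_left {K : Set ℝ} {c : ℝ} {d : EReal} (h : IsGap K c d) :
    (d = ⊤ ∧ IsGreatest K c) ∨ ∃ x : ℝ, d = x ∧ IsBddGap K c x := by
  obtain ⟨h1, h2, h3, h4⟩ := h
  have hb : c ∈ K := by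
    rcases h2 with h3 | ⟨x, hx, e⟩
    · exact absurd h3 (EReal.coe_ne_bot c)
    · rwa [EReal.coe_eq_coe_iff.1 e]
  rcases h3 with rfl | ⟨x, hx, rfl⟩
  · refine Or.inl ⟨rfl, hb, fun y hy => ?_⟩
    by_contra! hlt
    exact h4 y hy ⟨by exact_mod_cast hlt, EReal.coe_lt_top y⟩
  · refine Or.inr ⟨x, rfl, hb, hx, by exact_mod_cast h1, fun y hy => ?_⟩
    by_contra! hlt
    exact h4 y hy ⟨by exact_mod_cast hlt.1, by exact_mod_cast hlt.2⟩

@[simp]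
theorem gapLength_coe (a b : ℝ) : gapLength a b = ENNReal.ofReal (b - a) := by
  rw [gapLength, ← EReal.coe_sub, EReal.toENNReal_of_ne_top (EReal.coe_ne_top _), EReal.toReal_coe]

@[simp]
theorem gapLength_bot (b : ℝ) : gapLength ⊥ b = ⊤ := by simp [gapLength]

@[simp]
theorem gapLength_top (a : ℝ) : gapLength a ⊤ = ⊤ := by simp [gapLength]

theorem thickness_le {K : Set ℝ} {a d : EReal} {b c : ℝ} (h1 : IsGap K a b) (h2 : IsGap K c d)
    (hbc : b < c) (h : a ≠ ⊥ ∨ d ≠ ⊤) : thickness K ≤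
      max (ENNReal.ofReal (c - b) / gapLength a b) (ENNReal.ofReal (c - b) / gapLength c d) :=
  iInf_le_of_le a <| iInf_le_of_le b <| iInf_le_of_le c <| iInf_le_of_le d <|
    iInf_le_of_le h1 <| iInf_le_of_le h2 <| iInf_le_of_le hbc <| iInf_le _ h

/-- A common endpoint would be an isolated point. This reconciles `b ≤ c` in `ThickAbove.pair` with
the strict `b < c` in `thickness`; `d` may also be chosen beyond the maximum. -/
theorem IsCantorSet.ne_of_isBddGap {K : Set ℝ} (hK : IsCantorSet K) {a b c d : ℝ}
    (h1 : IsBddGap K a b) (h2 : c ∈ K) (h3 : ∀ x ∈ K, x ≤ c ∨ d ≤ x) (hcd : c < d) : b ≠ c := by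
  rintro rfl
  obtain ⟨y, ⟨hy, hyK⟩, hne⟩ := preperfect_iff_nhds.1 hK.preperfect b h2 (Set.Ioo a d)
    (Ioo_mem_nhds h1.lt hcd)
  have h4 := (h1.le_or_le y hyK).resolve_left (not_le.2 hy.1)
  have h5 := (h3 y hyK).resolve_right (not_le.2 hy.2)
  exact hne (le_antisymm h5 h4)

theorem IsCantorSet.lt_of_isBddGap {K : Set ℝ} (hK : IsCantorSet K) {a b c d : ℝ}
    (h1 : IsBddGap K a b) (h2 : IsBddGap K c d) (h : b ≤ c) : b < c :=
  lt_of_le_of_ne h (hK.ne_of_isBddGap h1 h2.left_mem h2.le_or_le h2.lt)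

theorem IsCantorSet.lt_of_isGreatest {K : Set ℝ} (hK : IsCantorSet K) {a b m' : ℝ}
    (h1 : IsBddGap K a b) (h2 : IsGreatest K m') : b < m' :=
  lt_of_le_of_ne (h2.2 h1.right_mem) (hK.ne_of_isBddGap (d := m' + 1) h1 h2.1
    (fun x hx => Or.inl (h2.2 hx)) (by linarith))

theorem IsCantorSet.isLeast_lt {K : Set ℝ} (hK : IsCantorSet K) {a b m : ℝ}
    (h1 : IsBddGap K a b) (h2 : IsLeast K m) : m < a := by
  refine lt_of_le_of_ne (h2.2 h1.left_mem) ?_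
  rintro rfl
  obtain ⟨y, ⟨hy, hyK⟩, hne⟩ := preperfect_iff_nhds.1 hK.preperfect m h2.1 (Set.Iio b)
    (Iio_mem_nhds h1.lt)
  exact hne (le_antisymm ((h1.le_or_le y hyK).resolve_right (not_le.2 hy)) (h2.2 hyK))

theorem ENNReal.ofReal_le_ofReal_div_iff {M x y : ℝ} (hy : 0 < y) (hx : 0 ≤ x) :
    ENNReal.ofReal M ≤ ENNReal.ofReal x / ENNReal.ofReal y ↔ M * y ≤ x := by
  rw [← ENNReal.ofReal_div_of_pos hy, ENNReal.ofReal_le_ofReal_iff (by positivity),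
    le_div_iff₀ hy]

theorem IsCantorSet.isThick {K : Set ℝ} (hK : IsCantorSet K) {M m m' : ℝ}
    (hm : IsLeast K m) (hm' : IsGreatest K m') (h : ENNReal.ofReal M ≤ thickness K) :
    IsThick M K m m' := by
  refine ⟨hK.isCompact, hm, hm', ⟨fun a b hab _ => ?_, fun a b hab _ => ?_,
    fun a b c d hab hcd hbc _ _ => ?_⟩⟩
  · have hlt := hK.isLeast_lt hab hm
    have := h.trans (thickness_le (isGap_bot hm) hab.isGap hlt (Or.inr (EReal.coe_ne_top b)))
    simpa [ENNReal.ofReal_le_ofReal_div_iff (sub_pos.2 hab.lt) (sub_pos.2 hlt).le] using this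
  · have hlt := hK.lt_of_isGreatest hab hm'
    have := h.trans (thickness_le hab.isGap (isGap_top hm') hlt (Or.inl (EReal.coe_ne_bot a)))
    simpa [ENNReal.ofReal_le_ofReal_div_iff (sub_pos.2 hab.lt) (sub_pos.2 hlt).le] using this
  · have hlt := hK.lt_of_isBddGap hab hcd hbc
    have := h.trans (thickness_le hab.isGap hcd.isGap hlt (Or.inl (EReal.coe_ne_bot a)))
    simpa [ENNReal.ofReal_le_ofReal_div_iff (sub_pos.2 hab.lt) (sub_pos.2 hlt).le,
      ENNReal.ofReal_le_ofReal_div_iff (sub_pos.2 hcd.lt) (sub_pos.2 hlt).le] using this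

theorem IsThick.le_thickness {K : Set ℝ} {M m m' : ℝ} (h : IsThick M K m m') :
    ENNReal.ofReal M ≤ thickness K := by
  refine le_iInf fun a => le_iInf fun b => le_iInf fun c => le_iInf fun d => le_iInf fun h1 =>
    le_iInf fun h2 => le_iInf fun hbc => le_iInf fun hor => ?_
  have h0 := (sub_pos.2 hbc).le
  rcases h1.eq_or_isBddGap_right with ⟨rfl, hb⟩ | ⟨a, rfl, hab⟩ <;>
  rcases h2.eq_or_isBddGap_left with ⟨rfl, hc⟩ | ⟨d, rfl, hcd⟩
  · simp at hor
  · have := h.thickAbove.left _ _ hcd (sub_pos.2 hcd.lt).le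
    rw [h.isLeast.unique hb] at this
    simpa [ENNReal.ofReal_le_ofReal_div_iff (sub_pos.2 hcd.lt) h0] using this
  · have := h.thickAbove.right _ _ hab (sub_pos.2 hab.lt).le
    rw [h.isGreatest.unique hc] at this
    simpa [ENNReal.ofReal_le_ofReal_div_iff (sub_pos.2 hab.lt) h0] using this
  · have := h.thickAbove.pair _ _ _ _ hab hcd hbc.le (sub_pos.2 hab.lt).le (sub_pos.2 hcd.lt).le
    simpa [ENNReal.ofReal_le_ofReal_div_iff (sub_pos.2 hab.lt) h0,
      ENNReal.ofReal_le_ofReal_div_iff (sub_pos.2 hcd.lt) h0] using this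

theorem IsCantorSet.thickness_le_of_isGreatest {K : Set ℝ} (hK : IsCantorSet K) {a b m' : ℝ}
    (hab : IsBddGap K a b) (hm' : IsGreatest K m') :
    thickness K ≤ ENNReal.ofReal ((m' - b) / (b - a)) := by
  have := thickness_le hab.isGap (isGap_top hm') (hK.lt_of_isGreatest hab hm')
    (Or.inl (EReal.coe_ne_bot a))
  simpa [ENNReal.ofReal_div_of_pos (sub_pos.2 hab.lt)] using this

theorem IsCantorSet.exists_isLeast_lt_isGreatest {K : Set ℝ} (hK : IsCantorSet K) :
    ∃ m m', m < m' ∧ IsLeast K m ∧ IsGreatest K m' := by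
  obtain ⟨m, hm⟩ := hK.isCompact.exists_isLeast hK.nonempty
  obtain ⟨m', hm'⟩ := hK.isCompact.exists_isGreatest hK.nonempty
  refine ⟨m, m', ?_, hm, hm'⟩
  obtain ⟨y, ⟨-, hy⟩, hne⟩ := preperfect_iff_nhds.1 hK.preperfect m hm.1 Set.univ Filter.univ_mem
  exact (lt_of_le_of_ne (hm.2 hy) hne.symm).trans_le (hm'.2 hy)

theorem IsCantorSet.thickness_ne_top {K : Set ℝ} (hK : IsCantorSet K) : thickness K ≠ ⊤ := by
  obtain ⟨m, m', hlt, hm, hm'⟩ := hK.exists_isLeast_lt_isGreatest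
  obtain ⟨x, hx, hxK⟩ : ∃ x ∈ Set.Ioo m m', x ∉ K := by
    by_contra! hsub
    have h1 : Set.Ioo m m' ⊆ interior (closure K) :=
      interior_maximal (fun x hx => subset_closure (hsub x hx)) isOpen_Ioo
    rw [show interior (closure K) = ∅ from hK.isNowhereDense] at h1
    exact h1 ⟨left_lt_add_div_two.2 hlt, add_div_two_lt_right.2 hlt⟩
  obtain ⟨a, b, hab, -, -⟩ := exists_isBddGap hK.isCompact hm.1 hm'.1 hx.1.le hx.2.le hxK
  exact ne_top_of_le_ne_top ENNReal.ofReal_ne_top (hK.thickness_le_of_isGreatest hab hm')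

theorem isBddGap_neg {K : Set ℝ} {a b : ℝ} (h : IsBddGap (-K) a b) : IsBddGap K (-b) (-a) :=
  ⟨h.right_mem, h.left_mem, neg_lt_neg h.lt, fun x hx => by
    rcases h.le_or_le (-x) (by simpa using hx) with h | h
    · exact Or.inr (by linarith)
    · exact Or.inl (by linarith)⟩

theorem IsThick.neg {K : Set ℝ} {M m m' : ℝ} (h : IsThick M K m m') :
    IsThick M (-K) (-m') (-m) := by
  refine ⟨h.isCompact.neg, ⟨by simpa using h.isGreatest.1, fun x hx => ?_⟩,
    ⟨by simpa using h.isLeast.1, fun x hx => ?_⟩,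
    ⟨fun a b hab hε => ?_, fun a b hab hε => ?_, fun a b c d hab hcd hbc h1 h2 => ?_⟩⟩
  · linarith [h.isGreatest.2 hx]
  · linarith [h.isLeast.2 hx]
  · linarith [h.thickAbove.right _ _ (isBddGap_neg hab) (by linarith)]
  · linarith [h.thickAbove.left _ _ (isBddGap_neg hab) (by linarith)]
  · rcases h.thickAbove.pair _ _ _ _ (isBddGap_neg hcd) (isBddGap_neg hab) (by linarith)
      (by linarith) (by linarith) with h | h
    · exact Or.inr (by linarith)
    · exact Or.inl (by linarith)

/-! ### Part (a) -/

theorem IsThick.mul_eq_Icc {K L : Set ℝ} {M N m' n n' : ℝ} (hM : 0 < M)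
    (hMN : 2 * M + 1 ≤ N * M ^ 2) (hK : IsThick M K 0 m') (hL : IsThick N L n n')
    (hm' : 0 < m') (hn : n < 0) (hn' : 0 < n') : K * L = Set.Icc (m' * n) (m' * n') := by
  ext t
  constructor
  · rintro ⟨x, hx, y, hy, rfl⟩
    have hx0 := hK.isLeast.2 hx
    have hxm := hK.isGreatest.2 hx
    constructor
    · nlinarith [hL.isLeast.2 hy]
    · nlinarith [hL.isGreatest.2 hy]
  · rintro ⟨h1, h2⟩
    rcases lt_trichotomy t 0 with ht | rfl | ht
    · have := mem_mul_of_pos (t := -t) hM hMN hK hL.neg hm' (by linarith) (by linarith)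
        (by linarith)
      obtain ⟨x, hx, y, hy, e⟩ := this
      exact ⟨x, hx, -y, hy, by simp only at e ⊢; linarith⟩
    · exact ⟨0, hK.isLeast.1, n, hL.isLeast.1, zero_mul n⟩
    · exact mem_mul_of_pos hM hMN hK hL hm' hn.le ht h2

theorem mul_eq_Icc_of_thickness {K L : Set ℝ} (hK : IsZeroPlusCantorSet K) (hL : IsCantorSet L)
    (hpos : (posPart' L).Nonempty) (hneg : (negPart' L).Nonempty)
    (h : (2 * thickness K + 1) / thickness K ^ 2 ≤ thickness L) :
    ∃ a b : ℝ, a < b ∧ K * L = Set.Icc a b := by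
  obtain ⟨m, m', hmm, hm, hm'⟩ := hK.isCantorSet.exists_isLeast_lt_isGreatest
  obtain rfl := hm.unique hK.isLeast
  obtain ⟨n, n', -, hn, hn'⟩ := hL.exists_isLeast_lt_isGreatest
  obtain ⟨M, hM0, hM⟩ : ∃ M : ℝ, 0 ≤ M ∧ ENNReal.ofReal M = thickness K :=
    ⟨_, ENNReal.toReal_nonneg, ENNReal.ofReal_toReal hK.isCantorSet.thickness_ne_top⟩
  obtain ⟨N, hN0, hN⟩ : ∃ N : ℝ, 0 ≤ N ∧ ENNReal.ofReal N = thickness L :=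
    ⟨_, ENNReal.toReal_nonneg, ENNReal.ofReal_toReal hL.thickness_ne_top⟩
  have hMpos : 0 < M := by
    -- If `τ(K) = 0`, the quotient is `1 / 0 = ∞`, whereas `τ(L)` is finite.
    rcases hM0.eq_or_lt with h0 | h0
    · subst h0
      rw [← hM, ← hN] at h
      simp at h
    · exact h0
  have hMN : 2 * M + 1 ≤ N * M ^ 2 := by
    rw [← div_le_iff₀ (by positivity), ← ENNReal.ofReal_le_ofReal_iff hN0, hN,
      ENNReal.ofReal_div_of_pos (by positivity), ENNReal.ofReal_add (by positivity) zero_le_one,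
      ENNReal.ofReal_mul zero_le_two, ENNReal.ofReal_pow hM0, hM]
    simpa using h
  have hn0 : n < 0 := by
    obtain ⟨x, hx, hx0⟩ := hneg
    have hx0 : -x < 0 := hx0
    exact (hn.2 hx).trans_lt hx0
  have hn0' : 0 < n' := by
    obtain ⟨x, hx, hx0⟩ := hpos
    have hx0 : 0 < x := hx0
    exact hx0.trans_le (hn'.2 hx)
  exact ⟨_, _, by nlinarith, IsThick.mul_eq_Icc hMpos hMN
    (hK.isCantorSet.isThick hm hm' hM.le) (hL.isThick hn hn' hN.le) hmm hn0 hn0'⟩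

/-! ### Unions and affine images -/

theorem IsBddGap.of_union {A B : Set ℝ} {m₁ m₂ a b : ℝ} (hA : IsGreatest A m₁)
    (hB : IsLeast B m₂) (h12 : m₁ < m₂) (h : IsBddGap (A ∪ B) a b) :
    IsBddGap A a b ∨ IsBddGap B a b ∨ (a = m₁ ∧ b = m₂) := by
  rcases h.left_mem with ha | ha <;> rcases h.right_mem with hb | hb
  · exact Or.inl ⟨ha, hb, h.lt, fun x hx => h.le_or_le x (Or.inl hx)⟩
  · refine Or.inr (Or.inr ⟨?_, ?_⟩)
    · rcases h.le_or_le m₁ (Or.inl hA.1) with h1 | h1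
      · exact le_antisymm (hA.2 ha) h1
      · linarith [hB.2 hb]
    · rcases h.le_or_le m₂ (Or.inr hB.1) with h1 | h1
      · linarith [hA.2 ha]
      · exact le_antisymm h1 (hB.2 hb)
  · linarith [hA.2 hb, hB.2 ha, h.lt]
  · exact Or.inr (Or.inl ⟨ha, hb, h.lt, fun x hx => h.le_or_le x (Or.inr hx)⟩)

theorem isBddGap_union {A B : Set ℝ} {m₁ m₂ : ℝ} (hA : IsGreatest A m₁)
    (hB : IsLeast B m₂) (h12 : m₁ < m₂) : IsBddGap (A ∪ B) m₁ m₂ :=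
  ⟨Or.inl hA.1, Or.inr hB.1, h12, fun _ hx => hx.imp (fun h => hA.2 h) (fun h => hB.2 h)⟩

/-- Gaps on opposite sides of `(m₁, m₂)` need no new condition: the distance between them contains
the stretch from the left one to `m₁`, already long enough by `hA.right`. Only the new gap has to be
tested against both hulls. -/
theorem ThickAbove.union {A B : Set ℝ} {ε M m₀ m₁ m₂ m₃ : ℝ} (hA : ThickAbove ε M A m₀ m₁)
    (hB : ThickAbove ε M B m₂ m₃) (hm₀ : IsLeast A m₀) (hm₁ : IsGreatest A m₁)
    (hm₂ : IsLeast B m₂) (hm₃ : IsGreatest B m₃) (h12 : m₁ < m₂)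
    (hl : M * (m₂ - m₁) ≤ m₁ - m₀) (hr : M * (m₂ - m₁) ≤ m₃ - m₂) :
    ThickAbove ε M (A ∪ B) m₀ m₃ := by
  have h01 := hm₀.2 hm₁.1
  have h23 := hm₂.2 hm₃.1
  refine ⟨fun a b hab hε => ?_, fun a b hab hε => ?_, fun a b c d hab hcd hbc h1 h2 => ?_⟩
  · rcases hab.of_union hm₁ hm₂ h12 with h | h | ⟨rfl, rfl⟩
    · exact hA.left _ _ h hε
    · linarith [hB.left _ _ h hε]
    · exact hl
  · rcases hab.of_union hm₁ hm₂ h12 with h | h | ⟨rfl, rfl⟩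
    · linarith [hA.right _ _ h hε]
    · exact hB.right _ _ h hε
    · exact hr
  · rcases hab.of_union hm₁ hm₂ h12 with h | h | ⟨rfl, rfl⟩ <;>
    rcases hcd.of_union hm₁ hm₂ h12 with h' | h' | ⟨rfl, rfl⟩
    · exact hA.pair _ _ _ _ h h' hbc h1 h2
    · exact Or.inl (by linarith [hA.right _ _ h h1, hm₂.2 h'.left_mem])
    · exact Or.inl (by linarith [hA.right _ _ h h1])
    · linarith [hm₁.2 h'.left_mem, hm₂.2 h.right_mem]
    · exact hB.pair _ _ _ _ h h' hbc h1 h2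
    · linarith [hm₂.2 h.right_mem]
    · linarith [hm₁.2 h'.left_mem]
    · exact Or.inr (by linarith [hB.left _ _ h' h2])
    · linarith

theorem IsLeast.union_of_lt {A B : Set ℝ} {m₀ m₁ m₂ : ℝ} (hm₀ : IsLeast A m₀)
    (hm₁ : IsGreatest A m₁) (hm₂ : IsLeast B m₂) (h12 : m₁ < m₂) : IsLeast (A ∪ B) m₀ :=
  ⟨Or.inl hm₀.1, fun _ hx => hx.elim (fun h => hm₀.2 h)
    (fun h => ((hm₁.2 hm₀.1).trans h12.le).trans (hm₂.2 h))⟩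

theorem IsGreatest.union_of_lt {A B : Set ℝ} {m₁ m₂ m₃ : ℝ} (hm₁ : IsGreatest A m₁)
    (hm₂ : IsLeast B m₂) (hm₃ : IsGreatest B m₃) (h12 : m₁ < m₂) : IsGreatest (A ∪ B) m₃ :=
  ⟨Or.inr hm₃.1, fun _ hx => hx.elim
    (fun h => (hm₁.2 h).trans (h12.le.trans (hm₂.2 hm₃.1))) (fun h => hm₃.2 h)⟩

theorem IsThick.union {A B : Set ℝ} {M m₀ m₁ m₂ m₃ : ℝ} (hA : IsThick M A m₀ m₁)
    (hB : IsThick M B m₂ m₃) (h12 : m₁ < m₂)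
    (hl : M * (m₂ - m₁) ≤ m₁ - m₀) (hr : M * (m₂ - m₁) ≤ m₃ - m₂) :
    IsThick M (A ∪ B) m₀ m₃ :=
  ⟨hA.isCompact.union hB.isCompact, hA.isLeast.union_of_lt hA.isGreatest hB.isLeast h12,
    hA.isGreatest.union_of_lt hB.isLeast hB.isGreatest h12,
    hA.thickAbove.union hB.thickAbove hA.isLeast hA.isGreatest hB.isLeast hB.isGreatest h12 hl hr⟩

theorem IsThick.mono {A : Set ℝ} {M T m m' : ℝ} (hMT : M ≤ T) (h : IsThick T A m m') :
    IsThick M A m m' := by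
  have key : ∀ a b, IsBddGap A a b → M * (b - a) ≤ T * (b - a) := fun a b hab =>
    mul_le_mul_of_nonneg_right hMT (sub_pos.2 hab.lt).le
  exact ⟨h.isCompact, h.isLeast, h.isGreatest,
    fun a b hab hε => (key a b hab).trans (h.thickAbove.left a b hab hε),
    fun a b hab hε => (key a b hab).trans (h.thickAbove.right a b hab hε),
    fun a b c d hab hcd hbc h1 h2 => (h.thickAbove.pair a b c d hab hcd hbc h1 h2).imp
      ((key a b hab).trans) ((key c d hcd).trans)⟩

theorem IsBddGap.of_affine {K : Set ℝ} {p s a b : ℝ} (hs : 0 < s)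
    (h : IsBddGap ((fun x => p + s * x) '' K) a b) :
    ∃ a' b', a = p + s * a' ∧ b = p + s * b' ∧ IsBddGap K a' b' := by
  obtain ⟨⟨a', ha, rfl⟩, ⟨b', hb, rfl⟩, h3, h4⟩ := h
  refine ⟨a', b', rfl, rfl, ha, hb, by nlinarith, fun x hx => ?_⟩
  rcases h4 _ ⟨x, hx, rfl⟩ with h | h
  · exact Or.inl (le_of_mul_le_mul_left (by simpa using h) hs)
  · exact Or.inr (le_of_mul_le_mul_left (by simpa using h) hs)

theorem ThickAbove.affine {K : Set ℝ} {ε M m m' p s : ℝ} (hs : 0 < s)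
    (h : ThickAbove ε M K m m') :
    ThickAbove (s * ε) M ((fun x => p + s * x) '' K) (p + s * m) (p + s * m') := by
  refine ⟨fun a b hab hε => ?_, fun a b hab hε => ?_, fun a b c d hab hcd hbc h1 h2 => ?_⟩
  · obtain ⟨a, b, rfl, rfl, hab'⟩ := hab.of_affine hs
    have := h.left _ _ hab' (le_of_mul_le_mul_left (by linarith) hs)
    linarith [mul_le_mul_of_nonneg_left this hs.le]
  · obtain ⟨a, b, rfl, rfl, hab'⟩ := hab.of_affine hs
    have := h.right _ _ hab' (le_of_mul_le_mul_left (by linarith) hs)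
    linarith [mul_le_mul_of_nonneg_left this hs.le]
  · obtain ⟨a, b, rfl, rfl, hab'⟩ := hab.of_affine hs
    obtain ⟨c, d, rfl, rfl, hcd'⟩ := hcd.of_affine hs
    rcases h.pair _ _ _ _ hab' hcd' (le_of_mul_le_mul_left (by linarith) hs)
      (le_of_mul_le_mul_left (by linarith) hs) (le_of_mul_le_mul_left (by linarith) hs) with h | h
    · exact Or.inl (by linarith [mul_le_mul_of_nonneg_left h hs.le])
    · exact Or.inr (by linarith [mul_le_mul_of_nonneg_left h hs.le])

theorem IsLeast.affine {K : Set ℝ} {m p s : ℝ} (hs : 0 < s) (h : IsLeast K m) :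
    IsLeast ((fun x => p + s * x) '' K) (p + s * m) := by
  refine ⟨⟨m, h.1, rfl⟩, ?_⟩
  rintro _ ⟨x, hx, rfl⟩
  have := h.2 hx
  simp only
  gcongr

theorem IsGreatest.affine {K : Set ℝ} {m p s : ℝ} (hs : 0 < s) (h : IsGreatest K m) :
    IsGreatest ((fun x => p + s * x) '' K) (p + s * m) := by
  refine ⟨⟨m, h.1, rfl⟩, ?_⟩
  rintro _ ⟨x, hx, rfl⟩
  have := h.2 hx
  simp only
  gcongr

theorem IsThick.affine {K : Set ℝ} {M m m' p s : ℝ} (hs : 0 < s) (h : IsThick M K m m') :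
    IsThick M ((fun x => p + s * x) '' K) (p + s * m) (p + s * m') :=
  ⟨h.isCompact.image (by fun_prop), h.isLeast.affine hs, h.isGreatest.affine hs, by
    simpa using h.thickAbove.affine (p := p) hs⟩

theorem isNowhereDense_union {A B : Set ℝ} (hA : IsNowhereDense A) (hB : IsNowhereDense B) :
    IsNowhereDense (A ∪ B) := by
  unfold IsNowhereDense at *
  rw [closure_union, interior_union_isClosed_of_interior_empty isClosed_closure hB, hA]

theorem IsCantorSet.union {A B : Set ℝ} (hA : IsCantorSet A) (hB : IsCantorSet B) :
    IsCantorSet (A ∪ B) := by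
  refine ⟨hA.nonempty.inl, hA.isCompact.union hB.isCompact, ?_,
    isNowhereDense_union hA.isNowhereDense hB.isNowhereDense⟩
  rintro x (hx | hx)
  · exact (hA.preperfect x hx).mono (Filter.principal_mono.2 Set.subset_union_left)
  · exact (hB.preperfect x hx).mono (Filter.principal_mono.2 Set.subset_union_right)

theorem IsCantorSet.image_homeomorph {A : Set ℝ} (hA : IsCantorSet A) (f : ℝ ≃ₜ ℝ) :
    IsCantorSet (f '' A) := by
  refine ⟨hA.nonempty.image f, hA.isCompact.image f.continuous, ?_, ?_⟩
  · rw [preperfect_iff_nhds]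
    rintro _ ⟨x, hx, rfl⟩ U hU
    obtain ⟨y, ⟨hyU, hy⟩, hne⟩ := preperfect_iff_nhds.1 hA.preperfect x hx (f ⁻¹' U)
      (f.continuous.continuousAt.preimage_mem_nhds hU)
    exact ⟨f y, ⟨hyU, y, hy, rfl⟩, f.injective.ne hne⟩
  · rw [IsNowhereDense, ← f.image_closure, ← f.image_interior, hA.isNowhereDense, Set.image_empty]

theorem IsCantorSet.affine {A : Set ℝ} (hA : IsCantorSet A) {p s : ℝ} (hs : 0 < s) :
    IsCantorSet ((fun x => p + s * x) '' A) :=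
  hA.image_homeomorph ((Homeomorph.mulLeft₀ s hs.ne').trans (Homeomorph.addLeft p))

/-! ### Middle Cantor sets -/

/-- The approximations of the middle Cantor set with contraction ratio `β`. -/
def middleApprox (β : ℝ) : ℕ → Set ℝ
  | 0 => Set.Icc 0 1
  | n + 1 => {x | x / β ∈ middleApprox β n ∨ (x - (1 - β)) / β ∈ middleApprox β n}

/-- The middle Cantor set in `[0, 1]` with contraction ratio `β`. -/
def middleCantor (β : ℝ) : Set ℝ := ⋂ n, middleApprox β n

section

variable {β : ℝ}

theorem middleApprox_succ_subset (h0 : 0 < β) (h1 : β < 1 / 2) (n : ℕ) :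
    middleApprox β (n + 1) ⊆ middleApprox β n := by
  induction n with
  | zero =>
    rintro x (⟨hx, hx'⟩ | ⟨hx, hx'⟩)
    · rw [le_div_iff₀ h0] at hx
      rw [div_le_iff₀ h0] at hx'
      exact ⟨by linarith, by linarith⟩
    · rw [le_div_iff₀ h0] at hx
      rw [div_le_iff₀ h0] at hx'
      exact ⟨by linarith, by linarith⟩
  | succ n ih => exact fun x hx => hx.imp (fun h => ih h) (fun h => ih h)

theorem middleCantor_subset (β : ℝ) : middleCantor β ⊆ Set.Icc 0 1 := Set.iInter_subset _ 0

theorem isClosed_middleApprox (β : ℝ) (n : ℕ) : IsClosed (middleApprox β n) := by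
  induction n with
  | zero => exact isClosed_Icc
  | succ n ih =>
    exact (ih.preimage (f := fun x => x / β) (by fun_prop)).union
      (ih.preimage (f := fun x => (x - (1 - β)) / β) (by fun_prop))

theorem isCompact_middleCantor (β : ℝ) : IsCompact (middleCantor β) :=
  isCompact_Icc.of_isClosed_subset (isClosed_iInter (isClosed_middleApprox β))
    (middleCantor_subset β)

theorem isLeast_middleCantor (β : ℝ) : IsLeast (middleCantor β) 0 := by
  refine ⟨Set.mem_iInter.2 fun n => ?_, fun x hx => (middleCantor_subset β hx).1⟩
  induction n with
  | zero => exact ⟨le_rfl, zero_le_one⟩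
  | succ n ih => exact Or.inl (by simpa using ih)

theorem isGreatest_middleCantor (h0 : 0 < β) : IsGreatest (middleCantor β) 1 := by
  refine ⟨Set.mem_iInter.2 fun n => ?_, fun x hx => (middleCantor_subset β hx).2⟩
  induction n with
  | zero => exact ⟨zero_le_one, le_rfl⟩
  | succ n ih => exact Or.inr (by simpa [h0.ne'] using ih)

theorem mem_middleCantor_iff (h0 : 0 < β) (h1 : β < 1 / 2) {x : ℝ} :
    x ∈ middleCantor β ↔ x / β ∈ middleCantor β ∨ (x - (1 - β)) / β ∈ middleCantor β := by
  have hanti : Antitone (middleApprox β) := antitone_nat_of_succ_le (middleApprox_succ_subset h0 h1)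
  simp only [middleCantor, Set.mem_iInter]
  constructor
  · intro hx
    by_contra! h
    obtain ⟨⟨n, hn⟩, ⟨k, hk⟩⟩ := h
    rcases hx (max n k + 1) with h | h
    · exact hn (hanti (le_max_left n k) h)
    · exact hk (hanti (le_max_right n k) h)
  · intro h n
    have : x ∈ middleApprox β (n + 1) := h.imp (fun h => h n) (fun h => h n)
    exact middleApprox_succ_subset h0 h1 n this

theorem middleCantor_eq_union (h0 : 0 < β) (h1 : β < 1 / 2) : middleCantor β =
    (fun x => 0 + β * x) '' middleCantor β ∪ (fun x => (1 - β) + β * x) '' middleCantor β := by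
  ext x
  rw [mem_middleCantor_iff h0 h1]
  constructor
  · rintro (h | h)
    · exact Or.inl ⟨_, h, by field_simp; ring⟩
    · exact Or.inr ⟨_, h, by field_simp; ring⟩
  · rintro (⟨y, hy, rfl⟩ | ⟨y, hy, rfl⟩)
    · exact Or.inl (by simpa [h0.ne'] using hy)
    · exact Or.inr (by simpa [h0.ne'] using hy)

theorem exists_ne_mem_middleCantor (h0 : 0 < β) (h1 : β < 1 / 2) (n : ℕ) :
    ∀ x ∈ middleCantor β, ∃ y ∈ middleCantor β, y ≠ x ∧ |y - x| ≤ β ^ n := by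
  induction n with
  | zero =>
    intro x hx
    have hI := middleCantor_subset β hx
    rcases eq_or_ne x 0 with rfl | hne
    · exact ⟨1, (isGreatest_middleCantor h0).1, one_ne_zero, by simp⟩
    · exact ⟨0, (isLeast_middleCantor β).1, hne.symm, by
        rw [zero_sub, abs_neg, abs_of_nonneg hI.1]; simpa using hI.2⟩
  | succ n ih =>
    intro x hx
    rw [middleCantor_eq_union h0 h1] at hx ⊢
    rcases hx with ⟨x, hx, rfl⟩ | ⟨x, hx, rfl⟩ <;> obtain ⟨y, hy, hne, hd⟩ := ih x hx
    · refine ⟨_, Or.inl ⟨y, hy, rfl⟩, by simpa [h0.ne'] using hne, ?_⟩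
      rw [add_sub_add_left_eq_sub, ← mul_sub, abs_mul, abs_of_pos h0, pow_succ']
      gcongr
    · refine ⟨_, Or.inr ⟨y, hy, rfl⟩, by simpa [h0.ne'] using hne, ?_⟩
      rw [add_sub_add_left_eq_sub, ← mul_sub, abs_mul, abs_of_pos h0, pow_succ']
      gcongr

/-- An interval inside the set avoids the middle gap, so it lies in one of the two halves and can be
rescaled by `1 / β`. -/
theorem sub_le_pow_of_Icc_subset (h0 : 0 < β) (h1 : β < 1 / 2) (n : ℕ) :
    ∀ x y, x ≤ y → Set.Icc x y ⊆ middleCantor β → y - x ≤ β ^ n := by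
  induction n with
  | zero =>
    intro x y hxy h
    have hx := middleCantor_subset β (h ⟨le_rfl, hxy⟩)
    have hy := middleCantor_subset β (h ⟨hxy, le_rfl⟩)
    simp only [pow_zero]
    linarith [hx.1, hy.2]
  | succ n ih =>
    intro x y hxy h
    have hcase : ∀ z ∈ Set.Icc x y, (z ≤ β ∧ z / β ∈ middleCantor β) ∨
        (1 - β ≤ z ∧ (z - (1 - β)) / β ∈ middleCantor β) := by
      intro z hz
      refine ((mem_middleCantor_iff h0 h1).1 (h hz)).imp (fun h => ⟨?_, h⟩) (fun h => ⟨?_, h⟩)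
      · have := (middleCantor_subset β h).2
        rwa [div_le_one h0] at this
      · have := (middleCantor_subset β h).1
        rw [le_div_iff₀ h0] at this
        linarith
    have hside : y ≤ β ∨ 1 - β ≤ x := by
      by_contra! hc
      rcases hcase x ⟨le_rfl, hxy⟩ with h2 | h2
      · rcases hcase y ⟨hxy, le_rfl⟩ with h3 | h3
        · linarith
        · rcases hcase (1 / 2) ⟨by linarith, by linarith⟩ with h4 | h4 <;> linarith
      · linarith
    rcases hside with hs | hs
    · have := ih (x / β) (y / β) (by gcongr) (by
        rintro z ⟨hz1, hz2⟩
        rw [div_le_iff₀ h0] at hz1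
        rw [le_div_iff₀ h0] at hz2
        rcases hcase (z * β) ⟨hz1, hz2⟩ with h | h
        · simpa [h0.ne'] using h.2
        · linarith)
      rw [← sub_div, div_le_iff₀ h0] at this
      rwa [pow_succ]
    · have := ih ((x - (1 - β)) / β) ((y - (1 - β)) / β) (by gcongr) (by
        rintro z ⟨hz1, hz2⟩
        rw [div_le_iff₀ h0] at hz1
        rw [le_div_iff₀ h0] at hz2
        rcases hcase (z * β + (1 - β)) ⟨by linarith, by linarith⟩ with h | h
        · linarith
        · simpa [h0.ne'] using h.2)
      rw [← sub_div, div_le_iff₀ h0] at this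
      rw [pow_succ]
      linarith

theorem isCantorSet_middleCantor (h0 : 0 < β) (h1 : β < 1 / 2) : IsCantorSet (middleCantor β) := by
  refine ⟨⟨0, (isLeast_middleCantor β).1⟩, isCompact_middleCantor β, ?_, ?_⟩
  · rw [preperfect_iff_nhds]
    intro x hx U hU
    obtain ⟨ε, hε, hU⟩ := Metric.mem_nhds_iff.1 hU
    obtain ⟨n, hn⟩ := exists_pow_lt_of_lt_one hε (h1.trans one_half_lt_one)
    obtain ⟨y, hy, hne, hd⟩ := exists_ne_mem_middleCantor h0 h1 n x hx
    exact ⟨y, ⟨hU (by rw [Metric.mem_ball, Real.dist_eq]; linarith), hy⟩, hne⟩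
  · rw [IsNowhereDense, (isCompact_middleCantor β).isClosed.closure_eq, Set.eq_empty_iff_forall_notMem]
    intro x hx
    obtain ⟨ε, hε, hU⟩ := Metric.nhds_basis_closedBall.mem_iff.1 (mem_interior_iff_mem_nhds.1 hx)
    obtain ⟨n, hn⟩ := exists_pow_lt_of_lt_one hε (h1.trans one_half_lt_one)
    rw [Real.closedBall_eq_Icc] at hU
    have := sub_le_pow_of_Icc_subset h0 h1 n _ _ (by linarith) hU
    linarith

/-- The cutoff `β ^ n` makes self-similarity an induction: no gap has length `1`, and a gap of
length at least `β ^ (n + 1)` is the middle one or a scaled gap of length at least `β ^ n`. The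
value of `β` is the solution of `T * (1 - 2β) = β`. -/
theorem thickAbove_middleCantor {T : ℝ} (hT : 0 < T) (hβ : β = T / (2 * T + 1)) (n : ℕ) :
    ThickAbove (β ^ n) T (middleCantor β) 0 1 := by
  have hT' : 0 < 2 * T + 1 := by linarith
  have hβT : β * (2 * T + 1) = T := by rw [hβ]; field_simp
  have h0 : 0 < β := by rw [hβ]; positivity
  have h1 : β < 1 / 2 := by rw [hβ, div_lt_iff₀ hT']; linarith
  have hl := isLeast_middleCantor β
  have hg := isGreatest_middleCantor h0
  induction n with
  | zero =>
    have key : ∀ a b, IsBddGap (middleCantor β) a b → ¬ β ^ 0 ≤ b - a := by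
      intro a b hab hε
      have ha := hl.2 hab.left_mem
      have hb := hg.2 hab.right_mem
      rw [pow_zero] at hε
      obtain rfl : a = 0 := by linarith
      obtain rfl : b = 1 := by linarith
      have hβm : β ∈ middleCantor β :=
        (mem_middleCantor_iff h0 h1).2 (Or.inl (by rw [div_self h0.ne']; exact hg.1))
      rcases hab.le_or_le β hβm with h | h <;> linarith
    exact ⟨fun a b hab hε => absurd hε (key a b hab), fun a b hab hε => absurd hε (key a b hab),
      fun a b c d hab _ _ hε _ => absurd hε (key a b hab)⟩
  | succ n ih =>
    have h2 := ih.affine (p := 0) h0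
    have h3 := ih.affine (p := 1 - β) h0
    have hgap : T * (1 - β + β * 0 - (0 + β * 1)) = β := by linarith
    have h4 := h2.union h3 (hl.affine h0) (hg.affine h0) (hl.affine h0) (hg.affine h0)
      (by linarith) (by linarith) (by linarith)
    rw [← middleCantor_eq_union h0 h1, ← pow_succ'] at h4
    convert h4 using 1 <;> ring

theorem isThick_middleCantor {T : ℝ} (hT : 0 < T) (hβ : β = T / (2 * T + 1)) :
    IsThick T (middleCantor β) 0 1 := by
  have hT' : 0 < 2 * T + 1 := by linarith
  have h0 : 0 < β := by rw [hβ]; positivity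
  have h1 : β < 1 / 2 := by rw [hβ, div_lt_iff₀ hT']; linarith
  have hsmall : ∀ x : ℝ, 0 < x → ∃ n : ℕ, β ^ n ≤ x := fun x hx =>
    (exists_pow_lt_of_lt_one hx (h1.trans one_half_lt_one)).imp fun _ h => h.le
  refine ⟨isCompact_middleCantor β, isLeast_middleCantor β, isGreatest_middleCantor h0,
    fun a b hab _ => ?_, fun a b hab _ => ?_, fun a b c d hab hcd hbc _ _ => ?_⟩
  · obtain ⟨n, hn⟩ := hsmall _ (sub_pos.2 hab.lt)
    exact (thickAbove_middleCantor hT hβ n).left a b hab hn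
  · obtain ⟨n, hn⟩ := hsmall _ (sub_pos.2 hab.lt)
    exact (thickAbove_middleCantor hT hβ n).right a b hab hn
  · obtain ⟨n, hn⟩ := hsmall _ (lt_min (sub_pos.2 hab.lt) (sub_pos.2 hcd.lt))
    exact (thickAbove_middleCantor hT hβ n).pair a b c d hab hcd hbc
      (hn.trans (min_le_left _ _)) (hn.trans (min_le_right _ _))

end

/-! ### Geometric towers and part (b) -/

/-- Every interval is the convex hull of a Cantor set of any prescribed lower thickness bound. -/
theorem exists_isCantorSet_isThick {T : ℝ} (hT : 0 < T) {a b : ℝ} (hab : a < b) :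
    ∃ C, IsCantorSet C ∧ IsThick T C a b := by
  have hT' : 0 < 2 * T + 1 := by linarith
  have hs : 0 < b - a := sub_pos.2 hab
  refine ⟨(fun x => a + (b - a) * x) '' middleCantor (T / (2 * T + 1)),
    (isCantorSet_middleCantor (by positivity) ?_).affine hs, ?_⟩
  · rw [div_lt_iff₀ hT']; linarith
  · simpa using (isThick_middleCantor hT rfl).affine (p := a) hs

/-- Attaching to a Cantor set with maximum `ℓ` Cantor sets with convex hulls `μ ^ j * [1, ℓ]`. -/
theorem exists_geometric_extension {B : Set ℝ} {M T m μ ℓ : ℝ} (hM : 0 < M) (hMT : M ≤ T)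
    (hBC : IsCantorSet B) (hB : IsThick M B m ℓ) (hℓ : 1 < ℓ) (hμ : ℓ < μ)
    (hr : M * (μ - ℓ) = μ * (ℓ - 1)) (n : ℕ)
    (hl : ∀ j < n, M * (μ ^ j * (μ - ℓ)) ≤ μ ^ j * ℓ - m) :
    ∃ A, IsCantorSet A ∧ IsThick M A m (μ ^ n * ℓ) ∧ B ⊆ A ∧
      (∀ j, 1 ≤ j → j ≤ n → ∃ C ⊆ A, IsThick T C (μ ^ j) (μ ^ j * ℓ)) ∧
      (∀ x ∈ A, x ∈ B ∨ ∃ j, 1 ≤ j ∧ j ≤ n ∧ μ ^ j ≤ x ∧ x ≤ μ ^ j * ℓ) ∧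
      (1 ≤ n → thickness A = ENNReal.ofReal M) := by
  have hμ0 : 0 < μ := by linarith
  induction n with
  | zero =>
    exact ⟨B, hBC, by simpa using hB, subset_rfl, fun j h1 h2 => by omega,
      fun x hx => Or.inl hx, fun h => by omega⟩
  | succ n ih =>
    obtain ⟨A, hAC, hA, hBA, hpieces, hcover, -⟩ := ih (fun j hj => hl j (by omega))
    have hpn : 0 < μ ^ n := by positivity
    have hp : 0 < μ ^ (n + 1) := by positivity
    have hps : μ ^ (n + 1) = μ ^ n * μ := pow_succ _ _
    obtain ⟨C, hCC, hC⟩ := exists_isCantorSet_isThick (hM.trans_le hMT)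
      (show μ ^ (n + 1) < μ ^ (n + 1) * ℓ from lt_mul_of_one_lt_right hp hℓ)
    have hlt : μ ^ n * ℓ < μ ^ (n + 1) := by rw [hps]; gcongr
    have hgap : M * (μ ^ (n + 1) - μ ^ n * ℓ) = μ ^ (n + 1) * ℓ - μ ^ (n + 1) := by
      rw [hps]; linear_combination μ ^ n * hr
    have hU := hA.union (hC.mono hMT) hlt
      (by have := hl n (by omega); rw [hps]; linarith) hgap.le
    have hUC := hAC.union hCC
    refine ⟨A ∪ C, hUC, hU, hBA.trans Set.subset_union_left, ?_, ?_, fun _ => ?_⟩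
    · intro j h1 h2
      rcases Nat.le_succ_iff.1 h2 with h2 | rfl
      · obtain ⟨D, hD, hD'⟩ := hpieces j h1 h2
        exact ⟨D, hD.trans Set.subset_union_left, hD'⟩
      · exact ⟨C, Set.subset_union_right, hC⟩
    · rintro x (hx | hx)
      · exact (hcover x hx).imp_right fun ⟨j, h1, h2, h3⟩ => ⟨j, h1, by omega, h3⟩
      · exact Or.inr ⟨n + 1, by omega, le_rfl, hC.isLeast.2 hx, hC.isGreatest.2 hx⟩
    -- By `hr`, the bridge to the right of the last gap is exactly `M` times that gap, so the bound
    -- is attained.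
    · refine le_antisymm ?_ hU.le_thickness
      refine (hUC.thickness_le_of_isGreatest
        (isBddGap_union hA.isGreatest hC.isLeast hlt) hU.isGreatest).trans_eq ?_
      rw [← hgap, mul_div_cancel_right₀ _ (sub_pos.2 hlt).ne']

/-- The product of two geometric towers of thick Cantor sets. -/
theorem mul_eq_iUnion_Icc {K L : Set ℝ} {T μ κ ℓ q δ w : ℝ} {n : ℕ} (hn : 1 ≤ n) (hT : 2 ≤ T)
    (hκ : 1 < κ) (hℓ : 1 < ℓ) (hκℓ : κ * ℓ < μ) (hTκ : T + 1 ≤ T * κ) (hTℓ : T + 1 ≤ T * ℓ)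
    (hδ : 0 < δ) (hδ1 : δ ≤ 1) (hw : 2 ≤ w) (hwμ : μ ^ n ≤ w) (hq : 0 ≤ q)
    {K₀ L₀ : Set ℝ} (hK₀ : IsThick T K₀ 0 κ) (hL₀ : IsThick T L₀ (-w) (-δ)) (hK₀K : K₀ ⊆ K)
    (hL₀L : L₀ ⊆ L)
    (hKp : ∀ j, 1 ≤ j → j ≤ n → ∃ C ⊆ K, IsThick T C (μ ^ j) (μ ^ j * κ))
    (hLp : ∀ j, 1 ≤ j → j ≤ n → ∃ C ⊆ L, IsThick T C (μ ^ j) (μ ^ j * ℓ))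
    (hKc : ∀ x ∈ K, x ∈ Set.Icc 0 κ ∨ ∃ j, 1 ≤ j ∧ j ≤ n ∧ μ ^ j ≤ x ∧ x ≤ μ ^ j * κ)
    (hLc : ∀ x ∈ L, (x ∈ Set.Icc (-w) (-δ) ∨ x ∈ Set.Icc q ℓ) ∨
      ∃ j, 1 ≤ j ∧ j ≤ n ∧ μ ^ j ≤ x ∧ x ≤ μ ^ j * ℓ) :
    K * L = ⋃ i : Fin (n + 1), Set.Icc (if i.1 = 0 then -(μ ^ n * κ * w) else μ ^ (n + i.1))
      (μ ^ (n + i.1) * (κ * ℓ)) := by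
  have hκ0 : 0 < κ := by linarith
  have hℓ0 : 0 < ℓ := by linarith
  have hκℓ1 : 1 < κ * ℓ := by nlinarith
  have hμ : 1 < μ := by linarith
  have hμ0 : 0 < μ := by linarith
  have hmono : ∀ {i j : ℕ}, i ≤ j → μ ^ i ≤ μ ^ j := fun h => pow_le_pow_right₀ hμ.le h
  have hpos : ∀ j : ℕ, 0 < μ ^ j := fun j => by positivity
  have h1n : 1 ≤ μ ^ n := one_le_pow₀ hμ.le
  ext t
  simp only [Set.mem_iUnion]
  constructor
  · rintro ⟨x, hx, y, hy, rfl⟩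
    have hx0 : 0 ≤ x ∧ x ≤ μ ^ n * κ := by
      rcases hKc x hx with h | ⟨j, -, h2, h3, h4⟩
      · exact ⟨h.1, h.2.trans (le_mul_of_one_le_left hκ0.le h1n)⟩
      · refine ⟨(hpos j).le.trans h3, h4.trans ?_⟩
        have := hmono h2
        gcongr
    -- The interval of index `0` absorbs every product not exceeding `μ ^ n * (κ * ℓ)`.
    have hzero : -w ≤ y → x * y ≤ μ ^ n * (κ * ℓ) → ∃ i : Fin (n + 1), x * y ∈
        Set.Icc (if i.1 = 0 then -(μ ^ n * κ * w) else μ ^ (n + i.1))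
        (μ ^ (n + i.1) * (κ * ℓ)) := by
      intro h1 h2
      refine ⟨0, ?_, by simpa using h2⟩
      simp only [Fin.val_zero, if_true]
      have h3 := mul_le_mul_of_nonneg_left h1 hx0.1
      have h4 := mul_le_mul_of_nonneg_right hx0.2 (by linarith : 0 ≤ w)
      linarith
    rcases hLc y hy with (h | h) | ⟨j, h1, h2, h3, h4⟩
    · refine hzero h.1 ?_
      have : x * y ≤ 0 := mul_nonpos_of_nonneg_of_nonpos hx0.1 (by linarith [h.2])
      exact this.trans (by positivity)
    · refine hzero (by linarith [h.1]) ?_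
      have := mul_le_mul hx0.2 h.2 (hq.trans h.1) (by positivity)
      linarith
    · have hy0 : 0 < y := (hpos j).trans_le h3
      rcases hKc x hx with h | ⟨i, h5, h6, h7, h8⟩
      · refine hzero (by linarith) ?_
        have h9 := mul_le_mul h.2 h4 hy0.le hκ0.le
        have h10 := mul_le_mul_of_nonneg_right (hmono h2) (mul_pos hκ0 hℓ0).le
        linarith
      · have hlow : μ ^ (i + j) ≤ x * y := by
          rw [pow_add]; exact mul_le_mul h7 h3 (hpos j).le hx0.1
        have hup : x * y ≤ μ ^ (i + j) * (κ * ℓ) := by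
          have := mul_le_mul h8 h4 hy0.le (by positivity)
          rw [pow_add]; linarith
        rcases le_or_gt (i + j) n with hij | hij
        · refine hzero (by linarith) (hup.trans ?_)
          have := hmono hij
          gcongr
        · refine ⟨⟨i + j - n, by omega⟩, ?_⟩
          have e : n + (i + j - n) = i + j := by omega
          simp only [e, if_neg (show i + j - n ≠ 0 by omega)]
          exact ⟨hlow, hup⟩
  · rintro ⟨⟨i, hi⟩, h1, h2⟩
    simp only at h1 h2
    have hKr : ∀ j, (T + 1) * μ ^ j ≤ T * (μ ^ j * κ) := fun j => by
      have := mul_le_mul_of_nonneg_left hTκ (hpos j).le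
      linarith
    have hLr : ∀ j, (T + 1) * μ ^ j ≤ T * (μ ^ j * ℓ) := fun j => by
      have := mul_le_mul_of_nonneg_left hTℓ (hpos j).le
      linarith
    obtain ⟨C, hCK, hC⟩ := hKp n hn le_rfl
    rcases Nat.eq_zero_or_pos i with rfl | hi0
    · simp only [if_true, add_zero] at h1 h2
      rcases lt_trichotomy t 0 with ht | rfl | ht
      · have hneg : -t ∈ K * (-L) := by
          have hL₀' : IsThick T (-L₀) δ w := by simpa using hL₀.neg
          have hsub : -L₀ ⊆ -L := Set.neg_subset_neg.2 hL₀L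
          have hδw : (T + 1) * δ ≤ T * w := by nlinarith
          -- `K₀ * (-L₀)` reaches up to `κ * w`, and the top block of `K` times `-L₀` takes over
          -- from `μ ^ n * δ ≤ κ * w`.
          rcases le_or_gt (-t) (κ * w) with h | h
          · exact Set.mul_subset_mul hK₀K hsub (mem_mul_of_isThick hT hK₀ hL₀' le_rfl hδ.le hκ0
              (by rw [mul_zero]; positivity) hδw (by linarith) (by linarith) h)
          · refine Set.mul_subset_mul hCK hsub (mem_mul_of_isThick hT hC hL₀' (hpos n).le hδ.le
              (by positivity) (hKr n) hδw (by linarith) ?_ (by linarith))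
            have h3 := mul_le_mul hwμ hδ1 hδ.le (by linarith)
            have h4 := mul_le_mul_of_nonneg_right hκ.le (by linarith : 0 ≤ w)
            linarith
        obtain ⟨x, hx, y, hy, e⟩ := hneg
        exact ⟨x, hx, -y, hy, by simp only at e ⊢; linarith⟩
      · exact ⟨0, hK₀K hK₀.isLeast.1, _, hL₀L hL₀.isLeast.1, zero_mul _⟩
      · obtain ⟨D, hDL, hD⟩ := hLp n hn le_rfl
        exact Set.mul_subset_mul hK₀K hDL (mem_mul_of_isThick hT hK₀ hD le_rfl (hpos n).le hκ0
          (by rw [mul_zero]; positivity) (hLr n) ht (by linarith) (by linarith))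
    · rw [if_neg hi0.ne'] at h1
      obtain ⟨D, hDL, hD⟩ := hLp i hi0 (by omega)
      rw [pow_add] at h1 h2
      exact Set.mul_subset_mul hCK hDL (mem_mul_of_isThick hT hC hD (hpos n).le (hpos i).le
        (by positivity) (hKr n) (hLr i) ((mul_pos (hpos n) (hpos i)).trans_le h1) h1
        (by linarith))

theorem isDisjointUnion_iUnion_Icc {μ r s : ℝ} {n : ℕ} (hr : 1 < r) (hrμ : r < μ) (hs : s ≤ 0) :
    IsDisjointUnionOfClosedIntervals (n + 1) (⋃ i : Fin (n + 1),
      Set.Icc (if i.1 = 0 then s else μ ^ (n + i.1)) (μ ^ (n + i.1) * r)) := by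
  have hμ : 1 < μ := hr.trans hrμ
  have hμ0 : 0 < μ := by linarith
  have hlt : ∀ i j : Fin (n + 1), i < j →
      Disjoint (Set.Icc (if i.1 = 0 then s else μ ^ (n + i.1)) (μ ^ (n + i.1) * r))
        (Set.Icc (if j.1 = 0 then s else μ ^ (n + j.1)) (μ ^ (n + j.1) * r)) := by
    intro i j hij
    have hij : i.1 < j.1 := hij
    rw [if_neg (by omega : j.1 ≠ 0), Set.disjoint_left]
    rintro x ⟨-, h1⟩ ⟨h2, -⟩
    have h3 : μ ^ (n + i.1 + 1) ≤ μ ^ (n + j.1) := pow_le_pow_right₀ hμ.le (by omega)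
    rw [pow_succ] at h3
    have h4 : μ ^ (n + i.1) * r < μ ^ (n + i.1) * μ := by gcongr
    linarith
  refine ⟨_, _, fun i => ?_, fun i j hij => ?_, rfl⟩
  · split_ifs
    · exact hs.trans_lt (by positivity)
    · exact lt_mul_of_one_lt_right (by positivity) hr
  · rcases lt_or_gt_of_ne hij with h | h
    · exact hlt i j h
    · exact (hlt j i h).symm

/-- One construction for both types of `L`: `q = 0` puts `0` at the left end of `L₁`, while `q = δ`
leaves `0` inside the gap `(-δ, q)`. -/
theorem exists_mul_isDisjointUnion {M N : ℝ} (hM : 0 < M) (hN : 0 < N)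
    (hMN : N < (2 * M + 1) / M ^ 2) {n : ℕ} (hn : 1 ≤ n) {q δ : ℝ} (hδ : δ = 1 / (2 * N + 1))
    (hq : 0 ≤ q) (hqδ : q ≤ δ) :
    ∃ K L L₁ : Set ℝ, IsZeroPlusCantorSet K ∧ IsCantorSet L ∧ thickness K = ENNReal.ofReal M ∧
      thickness L = ENNReal.ofReal N ∧ IsDisjointUnionOfClosedIntervals (n + 1) (K * L) ∧
      L₁ ⊆ L ∧ IsCantorSet L₁ ∧ IsLeast L₁ q ∧ -δ ∈ L ∧ ∀ x ∈ L, x ≤ -δ ∨ q ≤ x := by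
  -- `μ` and `κ` solve `M (μ - κ) = κ = μ (κ - 1)`: each gap between blocks of `K` has both the
  -- stretch back to `0` and the next block exactly `M` times as long as itself. Below, `ℓ` solves
  -- the right-hand condition for `N`.
  obtain ⟨μ, hμ⟩ : ∃ μ, μ = (2 * M + 1) / M := ⟨_, rfl⟩
  obtain ⟨κ, hκ⟩ : ∃ κ, κ = (2 * M + 1) / (M + 1) := ⟨_, rfl⟩
  have hμ1 : 1 < μ := by rw [hμ, lt_div_iff₀ hM]; linarith
  have hμ0 : 0 < μ := by linarith
  obtain ⟨ℓ, hℓ⟩ : ∃ ℓ, ℓ = μ * (1 + N) / (μ + N) := ⟨_, rfl⟩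
  have hκ1 : 1 < κ := by rw [hκ, lt_div_iff₀ (by positivity)]; linarith
  have hκμ : κ < μ := by
    rw [hκ, hμ]
    exact div_lt_div_of_pos_left (by positivity) hM (by linarith)
  have hκM : M * (μ - κ) = κ := by rw [hκ, hμ]; field_simp; ring
  have hκr : M * (μ - κ) = μ * (κ - 1) := by rw [hκ, hμ]; field_simp; ring
  have hℓ1 : 1 < ℓ := by rw [hℓ, lt_div_iff₀ (by positivity)]; nlinarith
  have hℓμ : ℓ < μ := by rw [hℓ, div_lt_iff₀ (by positivity)]; nlinarith
  have hℓr : N * (μ - ℓ) = μ * (ℓ - 1) := by rw [hℓ]; field_simp; ring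
  have hκℓ : κ * ℓ < μ := by
    -- Equivalent to `N < (μ - κ) / (κ - 1)`, and this quotient is `(2M + 1) / M ^ 2`.
    have h1 : κ * (1 + N) < μ + N := by
      rw [lt_div_iff₀ (by positivity)] at hMN
      have e1 : κ * (M + 1) = 2 * M + 1 := by rw [hκ]; field_simp
      have e2 : μ * M = 2 * M + 1 := by rw [hμ]; field_simp
      have h2 : (κ * (1 + N)) * (M * (M + 1)) < (μ + N) * (M * (M + 1)) := by
        have e3 : (κ * (1 + N)) * (M * (M + 1)) = (2 * M + 1) * (1 + N) * M := by
          rw [← e1]; ring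
        have e4 : (μ + N) * (M * (M + 1)) = (2 * M + 1) * (M + 1) + N * (M * (M + 1)) := by
          rw [← e2]; ring
        rw [e3, e4]
        nlinarith
      exact lt_of_mul_lt_mul_right h2 (by positivity)
    rw [hℓ, ← mul_div_assoc, div_lt_iff₀ (by positivity)]
    nlinarith
  -- `T` exceeds `M`, `N` and `2`, and is large enough that the block ratios `κ`, `ℓ` are at least
  -- `(T + 1) / T`.
  obtain ⟨T, hT⟩ : ∃ T, T = M + N + 2 + 1 / (κ - 1) + 1 / (ℓ - 1) := ⟨_, rfl⟩
  have hk : 0 < 1 / (κ - 1) := one_div_pos.2 (sub_pos.2 hκ1)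
  have hl : 0 < 1 / (ℓ - 1) := one_div_pos.2 (sub_pos.2 hℓ1)
  have hT2 : 2 ≤ T := by linarith
  have hT0 : 0 < T := by linarith
  have hTκ : T + 1 ≤ T * κ := by
    have h1 : 1 / (κ - 1) ≤ T := by linarith
    rw [div_le_iff₀ (sub_pos.2 hκ1)] at h1
    linarith
  have hTℓ : T + 1 ≤ T * ℓ := by
    have h1 : 1 / (ℓ - 1) ≤ T := by linarith
    rw [div_le_iff₀ (sub_pos.2 hℓ1)] at h1
    linarith
  have hδN : δ * (2 * N + 1) = 1 := by rw [hδ]; field_simp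
  have hδ0 : 0 < δ := by rw [hδ]; positivity
  have hδ1 : δ ≤ 1 := by nlinarith
  -- A long negative block supplies the left bridges of all gaps of `L` to its right; the term `μ ^
  -- n` serves the overlap of the negative products.
  obtain ⟨w, hw⟩ : ∃ w, w = 2 + N * μ ^ (n + 1) + μ ^ n := ⟨_, rfl⟩
  have hp0 : 0 < N * μ ^ (n + 1) := by positivity
  have hp1 : 0 < μ ^ n := by positivity
  obtain ⟨K₀, hK₀C, hK₀⟩ := exists_isCantorSet_isThick hT0 (show (0 : ℝ) < κ by linarith)
  obtain ⟨L₀, hL₀C, hL₀⟩ := exists_isCantorSet_isThick hT0 (show -w < -δ by linarith)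
  obtain ⟨L₁, hL₁C, hL₁⟩ := exists_isCantorSet_isThick hT0 (show q < ℓ by linarith)
  -- The gap has length at most `2δ`, and `δ` is chosen so that `N * 2δ = 1 - δ`, less than the
  -- length `ℓ - q` of the hull of `L₁`.
  have hNq : N * (q - -δ) ≤ 1 - δ := by nlinarith
  have hB := (hL₀.mono (by linarith)).union (hL₁.mono (by linarith)) (by linarith)
    (show N * (q - -δ) ≤ -δ - -w by linarith) (by linarith)
  obtain ⟨K, hKC, hK, hKs, hKp, hKc, hKt⟩ := exists_geometric_extension hM
    (show M ≤ T by linarith) hK₀C (hK₀.mono (by linarith)) hκ1 hκμ hκr n (fun j _ => by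
      have : M * (μ ^ j * (μ - κ)) = μ ^ j * κ := by linear_combination μ ^ j * hκM
      rw [this, sub_zero])
  obtain ⟨L, hLC, hL, hLs, hLp, hLc, hLt⟩ := exists_geometric_extension hN
    (show N ≤ T by linarith) (hL₀C.union hL₁C) hB hℓ1 hℓμ hℓr n (fun j hj => by
      have h1 : μ ^ (j + 1) ≤ μ ^ (n + 1) := pow_le_pow_right₀ hμ1.le (by omega)
      have h2 := mul_le_mul_of_nonneg_left h1 hN.le
      have h3 : 0 < μ ^ j * ℓ := by positivity
      have h4 := mul_pos hN h3
      rw [pow_succ] at h2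
      linarith)
  refine ⟨K, L, L₁, ⟨hKC, hK.isLeast⟩, hLC, hKt hn, hLt hn, ?_,
    Set.subset_union_right.trans hLs, hL₁C, hL₁.isLeast, hLs (Or.inl hL₀.isGreatest.1), ?_⟩
  · rw [mul_eq_iUnion_Icc hn hT2 hκ1 hℓ1 hκℓ hTκ hTℓ hδ0 hδ1 (by linarith) (by linarith) hq hK₀
      hL₀ hKs (Set.subset_union_left.trans hLs) hKp hLp
      (fun x hx => (hKc x hx).imp_left fun h => ⟨hK₀.isLeast.2 h, hK₀.isGreatest.2 h⟩)
      (fun x hx => (hLc x hx).imp_left fun h => h.imp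
        (fun h => ⟨hL₀.isLeast.2 h, hL₀.isGreatest.2 h⟩)
        (fun h => ⟨hL₁.isLeast.2 h, hL₁.isGreatest.2 h⟩))]
    refine isDisjointUnion_iUnion_Icc (by nlinarith) hκℓ ?_
    have : 0 < μ ^ n * κ * w := mul_pos (mul_pos hp1 (by linarith)) (by linarith)
    linarith
  · intro x hx
    rcases hLc x hx with (h | h) | ⟨j, -, -, h, -⟩
    · exact Or.inl (hL₀.isGreatest.2 h)
    · exact Or.inr (hL₁.isLeast.2 h)
    · exact Or.inr (by linarith [one_le_pow₀ hμ1.le (n := j)])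

theorem mainTheorem5 :
    (∀ K L : Set ℝ, IsZeroPlusCantorSet K →
      (IsZeroPlusMinusCantorSet L ∨ IsZeroTimesCantorSet L) →
      (2 * thickness K + 1) / thickness K ^ 2 ≤ thickness L →
      ∃ a b : ℝ, a < b ∧ K * L = Set.Icc a b) ∧
    (∀ M N : ℝ, 0 < M → 0 < N → N < (2 * M + 1) / M ^ 2 → ∀ k : ℕ, 2 ≤ k →
      (∃ K L : Set ℝ, IsZeroPlusCantorSet K ∧ IsZeroPlusMinusCantorSet L ∧
        thickness K = ENNReal.ofReal M ∧ thickness L = ENNReal.ofReal N ∧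
        IsDisjointUnionOfClosedIntervals k (K * L)) ∧
      (∃ K L : Set ℝ, IsZeroPlusCantorSet K ∧ IsZeroTimesCantorSet L ∧
        thickness K = ENNReal.ofReal M ∧ thickness L = ENNReal.ofReal N ∧
        IsDisjointUnionOfClosedIntervals k (K * L))) := by
  refine ⟨fun K L hK hL h => ?_, fun M N hM hN hMN k hk => ?_⟩
  · rcases hL with hL | hL
    · exact mul_eq_Icc_of_thickness hK hL.isCantorSet hL.pos_nonempty hL.neg_nonempty h
    · exact mul_eq_Icc_of_thickness hK hL.isCantorSet hL.pos_nonempty hL.neg_nonempty h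
  · obtain ⟨n, rfl⟩ : ∃ n, k = n + 1 := ⟨k - 1, by omega⟩
    have hδ : 0 < 1 / (2 * N + 1) := by positivity
    constructor
    · obtain ⟨K, L, L₁, hK, hL, hKt, hLt, hU, hsub, hL₁, hleast, hneg, hcov⟩ :=
        exists_mul_isDisjointUnion hM hN hMN (n := n) (by omega) rfl le_rfl hδ.le
      have hsmall : ∀ ε > 0, ∃ y ∈ posPart' L, y < ε := by
        intro ε hε
        obtain ⟨y, ⟨hyε, hy⟩, hne⟩ := preperfect_iff_nhds.1 hL₁.preperfect 0 hleast.1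
          (Set.Iio ε) (Iio_mem_nhds hε)
        exact ⟨y, ⟨hsub hy, lt_of_le_of_ne (hleast.2 hy) hne.symm⟩, hyε⟩
      have hbdd : ∀ y ∈ posPart' L, 0 ≤ y := fun y hy => le_of_lt hy.2
      have hnegne : (negPart' L).Nonempty :=
        ⟨1 / (2 * N + 1), hneg, neg_lt_zero.2 hδ⟩
      refine ⟨K, L, hK, ⟨hL, (hsmall 1 one_pos).imp fun _ h => h.1, hnegne, ?_, ?_⟩, hKt, hLt, hU⟩
      · refine le_antisymm (le_of_forall_pos_lt_add fun ε hε => ?_) (Real.sInf_nonneg hbdd)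
        obtain ⟨y, hy, hyε⟩ := hsmall ε hε
        rw [zero_add]
        exact (csInf_le ⟨0, hbdd⟩ hy).trans_lt hyε
      · refine hδ.trans_le (le_csInf hnegne fun y hy => ?_)
        obtain ⟨hyL, hy0⟩ := hy
        have hy0 : -y < 0 := hy0
        rcases hcov _ hyL with h | h <;> linarith
    · obtain ⟨K, L, L₁, hK, hL, hKt, hLt, hU, hsub, -, hleast, hneg, hcov⟩ :=
        exists_mul_isDisjointUnion hM hN hMN (n := n) (by omega) rfl hδ.le le_rfl
      refine ⟨K, L, hK, ⟨hL, ⟨_, hsub hleast.1, hδ⟩, ⟨1 / (2 * N + 1), hneg, neg_lt_zero.2 hδ⟩,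
        fun h0 => ?_⟩, hKt, hLt, hU⟩
      rcases hcov 0 h0 with h | h <;> linarith
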